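/- Theorem (Bergman and Shelah). Let $\Omega$ be a countably infinite set and let $S=\mathrm{Sym}(\Omega)$ be the group of all permutations of $\Omega$, equipped with the function topology, in which the sets $\{f\in S : f(\alpha)=\beta\}$ $(\alpha,\beta\in\Omega)$ form a subbasis of open sets. For subgroups $G_1,G_2\subseteq S$ write $G_1\approx_S G_2$ if there is a finite set $U\subseteq S$ such that the group generated by $G_1\cup U$ equals the group generated by $G_2\cup U$. For a subgroup $G\subseteq S$ and $\Sigma\subseteq\Omega$ let $G_{(\Sigma)}=\{f\in G : f(\alpha)=\alpha \text{ for all } \alpha\in\Sigma\}$. Then $\approx_S$ is an equivalence relation on the subgroups of $S$, and the subgroups of $S$ that are closed in the function topology fall into exactly four equivalence classes with respect to $\approx_S$, as follows. Every closed subgroup $G$ of $S$ satisfies exactly one of the following four conditions: (i) $G_{(\Sigma)}$ has an infinite orbit for every finite $\Sigma\subseteq\Omega$. (ii) There exists a finite set $\Sigma\subseteq\Omega$ such that all orbits of $G_{(\Sigma)}$ are finite, but for every finite $\Sigma\subseteq\Omega$ the cardinalities of the orbits of $G_{(\Sigma)}$ have no common finite bound. (iii) There exist a finite set $\Sigma\subseteq\Omega$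 and a positive integer $n$ such that the cardinalities of all orbits of $G_{(\Sigma)}$ are bounded by $n$, but $G_{(\Sigma)}\neq\{1\}$ for every finite $\Sigma\subseteq\Omega$. (iv) There exists a finite set $\Sigma\subseteq\Omega$ such that $G_{(\Sigma)}=\{1\}$. Two closed subgroups $G_1,G_2$ of $S$ satisfy $G_1\approx_S G_2$ if and only if they satisfy the same one of these conditions, and each of the four conditions is satisfied by some closed subgroup of $S$. -/

import Mathlib

namespace PermGroupClasses

variable {Ω : Type*}

/-- The function topology on `Sym(Ω)`: the sets `{f | f α = β}` form a subbasis of open sets. -/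
@[reducible]
def functionTopology (Ω : Type*) : TopologicalSpace (Equiv.Perm Ω) :=
  TopologicalSpace.generateFrom {s | ∃ α β : Ω, s = {f : Equiv.Perm Ω | f α = β}}

/-- `G` is closed in the function topology on `Sym(Ω)`. -/
def IsClosedSubgroup (G : Subgroup (Equiv.Perm Ω)) : Prop :=
  @IsClosed _ (functionTopology Ω) (G : Set (Equiv.Perm Ω))

/-- `G₁ ≈_S G₂`: for some finite set `U` of permutations, `G₁ ∪ U` and `G₂ ∪ U` generate the
same group. -/
def SEquiv (G₁ G₂ : Subgroup (Equiv.Perm Ω)) : Prop :=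
  ∃ U : Set (Equiv.Perm Ω), U.Finite ∧
    Subgroup.closure ((G₁ : Set (Equiv.Perm Ω)) ∪ U) =
      Subgroup.closure ((G₂ : Set (Equiv.Perm Ω)) ∪ U)

/-- The pointwise stabilizer `G_(Σ) = {f ∈ G | f α = α for all α ∈ Σ}`. -/
def pointwiseStabilizer (G : Subgroup (Equiv.Perm Ω)) (T : Set Ω) :
    Subgroup (Equiv.Perm Ω) where
  carrier := {f | f ∈ G ∧ ∀ α ∈ T, f α = α}
  one_mem' := ⟨G.one_mem, fun _ _ => rfl⟩
  mul_mem' := by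
    rintro f g ⟨hf, hf'⟩ ⟨hg, hg'⟩
    exact ⟨G.mul_mem hf hg, fun α hα => by rw [Equiv.Perm.mul_apply, hg' α hα, hf' α hα]⟩
  inv_mem' := by
    rintro f ⟨hf, hf'⟩
    exact ⟨G.inv_mem hf, fun α hα => by rw [Equiv.Perm.inv_eq_iff_eq, hf' α hα]⟩

/-- Every stabilizer of a finite set has an infinite orbit. -/
def HasInfiniteOrbits (G : Subgroup (Equiv.Perm Ω)) : Prop :=
  ∀ T : Set Ω, T.Finite →
    ∃ α : Ω, (MulAction.orbit (pointwiseStabilizer G T) α).Infinite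

/-- Some stabilizer of a finite set has only finite orbits, but no stabilizer of a finite set
has orbits of bounded finite cardinality. -/
def HasFiniteUnboundedOrbits (G : Subgroup (Equiv.Perm Ω)) : Prop :=
  (∃ T : Set Ω, T.Finite ∧
    ∀ α : Ω, (MulAction.orbit (pointwiseStabilizer G T) α).Finite) ∧
  ∀ T : Set Ω, T.Finite →
    ¬ ∃ n : ℕ, ∀ α : Ω, (MulAction.orbit (pointwiseStabilizer G T) α).encard ≤ n

/-- Some stabilizer of a finite set has orbits of bounded finite cardinality, but no stabilizer
of a finite set is trivial. -/
def HasBoundedNontrivialOrbits (G : Subgroup (Equiv.Perm Ω)) : Prop :=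
  (∃ T : Set Ω, T.Finite ∧ ∃ n : ℕ, 0 < n ∧
    ∀ α : Ω, (MulAction.orbit (pointwiseStabilizer G T) α).encard ≤ n) ∧
  ∀ T : Set Ω, T.Finite → pointwiseStabilizer G T ≠ ⊥

/-- Some stabilizer of a finite set is trivial. -/
def HasTrivialStabilizer (G : Subgroup (Equiv.Perm Ω)) : Prop :=
  ∃ T : Set Ω, T.Finite ∧ pointwiseStabilizer G T = ⊥

/-- The four conditions, as a family indexed by `Fin 4`. -/
def orbitCondition (i : Fin 4) (G : Subgroup (Equiv.Perm Ω)) : Prop :=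
  match i with
  | 0 => HasInfiniteOrbits G
  | 1 => HasFiniteUnboundedOrbits G
  | 2 => HasBoundedNontrivialOrbits G
  | 3 => HasTrivialStabilizer G

end PermGroupClasses

/-! Write G₁ ≼ G₂ (`Le`) if G₁ lies in a group generated by G₂ and finitely many permutations; ≈ is
the equivalence relation of this preorder (`sEquiv_iff`). Up to ≈ the four classes form a strictly
descending chain represented by Sym(Ω), the block permutations of blocks of sizes 0, 1, 2, …, those
of infinitely many blocks of size two, and the trivial group.

Upper bounds. Countably many permutations always lie in a finitely generated group
(`exists_finite_closure_of_countable`), so G is equivalent to the stabilizer of any finite set,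
which has countable index (`le_pointwiseStabilizer`). The stabilizer preserves its orbits, and the
group preserving a partition into finite blocks is absorbed by a representative with large enough
blocks (`blockGroup_le_blockCopy`); bounded blocks reduce to blocks of size two
(`blockGroup_le_iSup`).

Lower bounds use closedness. If orbits are unbounded, a tree of elements of G converging along
branches (`exists_tree`) sends chosen points to fresh places at each node. One permutation s
prescribed on those places simulates every block permutation as g⁻¹sg, where g is the limit along a
branch coding it; a commutator with a shift removes the uncontrolled part (`Realizes.blockCopy_le`).
If orbits are bounded, minimality of the bound lets the images of suitable points be chosen
independently (`realizes_two`). If orbits stay infinite, a permutation of ℕ is split into two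
factors preserving interval partitions (`exists_factorization`), and branch limits conjugate both
factors into one fixed group with finite blocks.

Separation. Elements generated by K and a finite set move points within balls of some radius r.
Finite balls exclude Sym(Ω), uniformly bounded balls exclude blocks of unbounded size, and
countability separates the last two classes. -/

namespace PermGroupClasses

open Equiv Set

/-! ### Matching, staged constructions and splitting of infinite sets -/

section Combinatorics

/-- Two colorings with equinumerous fibers differ by a permutation. -/
theorem exists_perm_comp_eq {X κ : Type*} (c c' : X → κ)
    (h : ∀ k, Nonempty ({x // c x = k} ≃ {x // c' x = k})) :
    ∃ σ : Perm X, ∀ x, c' (σ x) = c x := by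
  have E : ∀ k, {x // c x = k} ≃ {x // c' x = k} := fun k => (h k).some
  refine ⟨(sigmaFiberEquiv c).symm.trans
    ((Equiv.sigmaCongrRight fun k => E k).trans (sigmaFiberEquiv c')), fun x => ?_⟩
  exact ((E (c x)) ⟨x, rfl⟩).2

/-- Two embeddings whose ranges have infinite complement differ by a permutation. -/
theorem exists_perm_extending {X Y : Type*} [Countable Y] (e e' : X → Y)
    (he : Function.Injective e) (he' : Function.Injective e')
    (hc : (range e)ᶜ.Infinite) (hc' : (range e')ᶜ.Infinite) :
    ∃ σ : Perm Y, ∀ x, σ (e x) = e' x := by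
  classical
  have := hc.to_subtype
  have := hc'.to_subtype
  obtain ⟨E⟩ := nonempty_equiv_of_countable (α := ↥(range e)ᶜ) (β := ↥(range e')ᶜ)
  refine ⟨(Equiv.Set.sumCompl (range e)).symm.trans
    ((Equiv.sumCongr ((ofInjective e he).symm.trans (ofInjective e' he')) E).trans
      (Equiv.Set.sumCompl (range e'))), fun x => ?_⟩
  have h1 : (Equiv.Set.sumCompl (range e)).symm (e x) = Sum.inl ⟨e x, x, rfl⟩ :=
    Equiv.Set.sumCompl_symm_apply_of_mem (mem_range_self x)
  have h2 : (ofInjective e he).symm ⟨e x, x, rfl⟩ = x := by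
    rw [Equiv.symm_apply_eq]; rfl
  simp [h1, h2]

/-- A construction in stages: if every partial sequence satisfying `P` below `n` extends to
stage `n`, then there is a sequence satisfying `P` throughout. -/
theorem exists_seq_of_forall_extend {X : Type*} [Nonempty X] (P : ℕ → (ℕ → X) → Prop)
    (hP : ∀ n F F', (∀ m ≤ n, F m = F' m) → P n F → P n F')
    (h : ∀ n F, (∀ m < n, P m F) → ∃ x, P n (Function.update F n x)) :
    ∃ F, ∀ n, P n F := by
  classical
  have h' : ∀ n F, ∃ x, (∀ m < n, P m F) → P n (Function.update F n x) := by
    intro n F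
    by_cases hF : ∀ m < n, P m F
    · obtain ⟨x, hx⟩ := h n F hF
      exact ⟨x, fun _ => hx⟩
    · exact ⟨Classical.arbitrary X, fun h => absurd h hF⟩
  choose c hc using h'
  -- `S n` is the sequence after `n` choices, with default entries from `n` on. The result is the
  -- diagonal `S (n + 1) n`.
  let S : ℕ → ℕ → X := fun n =>
    Nat.rec (fun _ => Classical.arbitrary X) (fun n F => Function.update F n (c n F)) n
  have hS : ∀ n, S (n + 1) = Function.update (S n) n (c n (S n)) := fun _ => rfl
  have hagree : ∀ n m, m < n → S n m = S (m + 1) m := by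
    intro n
    induction n with
    | zero => intro m hm; omega
    | succ n ih =>
      intro m hm
      rcases Nat.lt_succ_iff_lt_or_eq.mp hm with hm | rfl
      · rw [hS, Function.update_of_ne (by omega), ih m hm]
      · rfl
  refine ⟨fun n => S (n + 1) n, fun n => ?_⟩
  induction n using Nat.strong_induction_on with
  | _ n ih =>
    have := hc n (S n) fun m hm => hP m _ _ (fun k hk => (hagree n k (by omega)).symm) (ih m hm)
    rw [← hS] at this
    exact hP n _ _ (fun k hk => hagree (n + 1) k (by omega)) this

/-- Countably many infinite sets can be split simultaneously into infinitely many infinite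
pieces. -/
theorem exists_splitting {X ι : Type*} [Countable ι] (A : ι → Set X)
    (hA : ∀ i, (A i).Infinite) :
    ∃ h : X → ℕ, ∀ i j, {x | x ∈ A i ∧ h x = j}.Infinite := by
  classical
  rcases isEmpty_or_nonempty ι with hι | hι
  · exact ⟨fun _ => 0, fun i => isEmptyElim i⟩
  obtain ⟨q, hq⟩ := exists_surjective_nat ι
  have : Nonempty X := (hA (q 0)).nonempty.nonempty
  let idx : ℕ → ι := fun n => q n.unpair.1
  obtain ⟨z, hz⟩ := exists_seq_of_forall_extend
    (fun n (F : ℕ → X) => F n ∈ A (idx n) ∧ ∀ m < n, F m ≠ F n)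
    (fun n F F' hF h => ⟨hF n le_rfl ▸ h.1, fun m hm => by
      rw [← hF m hm.le, ← hF n le_rfl]; exact h.2 m hm⟩)
    (fun n F _ => by
      obtain ⟨a, ha, ha'⟩ := (hA (idx n)).exists_notMem_finite ((finite_lt_nat n).image F)
      refine ⟨a, by simpa using ha, fun m hm => ?_⟩
      rw [Function.update_of_ne hm.ne, Function.update_self]
      rintro rfl
      exact ha' ⟨m, hm, rfl⟩)
  have hinj : Function.Injective z := by
    intro m n hmn
    rcases lt_trichotomy m n with h | h | h
    · exact absurd hmn ((hz n).2 m h)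
    · exact h
    · exact absurd hmn.symm ((hz m).2 n h)
  -- A stage codes a triple `(k, j, t)`: `k` names the set, `j` becomes the colour, and the free `t`
  -- supplies infinitely many points.
  refine ⟨fun x => (Function.invFun z x).unpair.2.unpair.1, fun i j => ?_⟩
  obtain ⟨k, rfl⟩ := hq i
  refine Set.infinite_of_injective_forall_mem
    (f := fun t : ℕ => z (Nat.pair k (Nat.pair j t))) ?_ ?_
  · intro s t hst
    have := hinj hst
    simpa [Nat.pair_eq_pair] using this
  · intro t
    refine ⟨?_, ?_⟩
    · have := (hz (Nat.pair k (Nat.pair j t))).1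
      simpa [idx] using this
    · simp [Function.leftInverse_invFun hinj _]

theorem exists_mem_notMem_of_encard_lt {X : Type*} {A B : Set X} (h : B.encard < A.encard) :
    ∃ a ∈ A, a ∉ B := by
  by_contra! hc
  exact absurd (encard_le_encard hc) (not_le.mpr h)

end Combinatorics

/-! ### The preorder of finite generation over a subgroup -/

section Preorder

variable {Ω : Type*}

/-- `G₁ ≼ G₂`: `G₁` is contained in a group finitely generated over `G₂`. -/
def Le (G₁ G₂ : Subgroup (Perm Ω)) : Prop :=
  ∃ U : Set (Perm Ω), U.Finite ∧ G₁ ≤ Subgroup.closure ((G₂ : Set (Perm Ω)) ∪ U)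

theorem le_closure_union_left (G : Subgroup (Perm Ω)) (U : Set (Perm Ω)) :
    G ≤ Subgroup.closure ((G : Set (Perm Ω)) ∪ U) := fun _ hx =>
  Subgroup.subset_closure (Or.inl hx)

theorem Le.of_le {G₁ G₂ : Subgroup (Perm Ω)} (h : G₁ ≤ G₂) : Le G₁ G₂ :=
  ⟨∅, finite_empty, h.trans (le_closure_union_left _ _)⟩

theorem Le.trans {G₁ G₂ G₃ : Subgroup (Perm Ω)} (h : Le G₁ G₂) (h' : Le G₂ G₃) : Le G₁ G₃ := by
  obtain ⟨U, hU, h⟩ := h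
  obtain ⟨V, hV, h'⟩ := h'
  refine ⟨V ∪ U, hV.union hU, h.trans ?_⟩
  rw [Subgroup.closure_le]
  rintro x (hx | hx)
  · exact Subgroup.closure_mono (by rw [← union_assoc]; exact subset_union_left) (h' hx)
  · exact Subgroup.subset_closure (Or.inr (Or.inr hx))

theorem Le.sup {G₁ G₂ G₃ : Subgroup (Perm Ω)} (h : Le G₁ G₃) (h' : Le G₂ G₃) :
    Le (G₁ ⊔ G₂) G₃ := by
  obtain ⟨U, hU, h⟩ := h
  obtain ⟨V, hV, h'⟩ := h'
  refine ⟨U ∪ V, hU.union hV, sup_le (h.trans (Subgroup.closure_mono ?_))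
    (h'.trans (Subgroup.closure_mono ?_))⟩
  · exact union_subset_union_right _ subset_union_left
  · exact union_subset_union_right _ subset_union_right

theorem Le.iSup {ι : Type*} [Finite ι] {G : ι → Subgroup (Perm Ω)} {H : Subgroup (Perm Ω)}
    (h : ∀ i, Le (G i) H) : Le (⨆ i, G i) H := by
  choose U hU h using h
  exact ⟨⋃ i, U i, finite_iUnion hU, iSup_le fun i => (h i).trans
    (Subgroup.closure_mono (union_subset_union_right _ (subset_iUnion U i)))⟩

/-- The conjugator itself is the only generator to be adjoined. -/
theorem Le.of_conj {G₁ G₂ : Subgroup (Perm Ω)} (σ : Perm Ω)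
    (h : ∀ f ∈ G₁, σ * f * σ⁻¹ ∈ G₂) : Le G₁ G₂ := by
  refine ⟨{σ}, finite_singleton σ, fun f hf => ?_⟩
  have hσ : σ ∈ Subgroup.closure ((G₂ : Set (Perm Ω)) ∪ {σ}) :=
    Subgroup.subset_closure (Or.inr rfl)
  have h1 := le_closure_union_left G₂ {σ} (h f hf)
  have := Subgroup.mul_mem _ (Subgroup.mul_mem _ (Subgroup.inv_mem _ hσ) h1) hσ
  simpa [mul_assoc] using this

theorem sEquiv_iff {G₁ G₂ : Subgroup (Perm Ω)} : SEquiv G₁ G₂ ↔ Le G₁ G₂ ∧ Le G₂ G₁ := by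
  constructor
  · rintro ⟨U, hU, h⟩
    exact ⟨⟨U, hU, h ▸ le_closure_union_left _ _⟩, ⟨U, hU, h ▸ le_closure_union_left _ _⟩⟩
  · rintro ⟨⟨U, hU, h⟩, V, hV, h'⟩
    refine ⟨U ∪ V, hU.union hV, le_antisymm ?_ ?_⟩
    · rw [Subgroup.closure_le]
      rintro x (hx | hx)
      · exact Subgroup.closure_mono (union_subset_union_right _ subset_union_left) (h hx)
      · exact Subgroup.subset_closure (Or.inr hx)
    · rw [Subgroup.closure_le]
      rintro x (hx | hx)
      · exact Subgroup.closure_mono (union_subset_union_right _ subset_union_right) (h' hx)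
      · exact Subgroup.subset_closure (Or.inr hx)

theorem sEquiv_equivalence : Equivalence (SEquiv (Ω := Ω)) where
  refl G := ⟨∅, finite_empty, rfl⟩
  symm := fun ⟨U, hU, h⟩ => ⟨U, hU, h.symm⟩
  trans h h' := by
    rw [sEquiv_iff] at *
    exact ⟨h.1.trans h'.1, h'.2.trans h.2⟩

end Preorder

/-! ### Closed subgroups and limits -/

section Closed

variable {Ω : Type*}

theorem pointwiseStabilizer_le (G : Subgroup (Perm Ω)) (T : Set Ω) :
    pointwiseStabilizer G T ≤ G := fun _ h => h.1

theorem pointwiseStabilizer_anti (G : Subgroup (Perm Ω)) {T T' : Set Ω} (h : T ⊆ T') :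
    pointwiseStabilizer G T' ≤ pointwiseStabilizer G T := fun _ hf =>
  ⟨hf.1, fun α hα => hf.2 α (h hα)⟩

theorem orbit_mono {G H : Subgroup (Perm Ω)} (h : G ≤ H) (α : Ω) :
    MulAction.orbit G α ⊆ MulAction.orbit H α := by
  rintro _ ⟨g, rfl⟩
  exact ⟨⟨g.1, h g.2⟩, rfl⟩

theorem mem_orbit_iff' {G : Subgroup (Perm Ω)} {α β : Ω} :
    β ∈ MulAction.orbit G α ↔ ∃ g ∈ G, g α = β :=
  ⟨fun ⟨g, h⟩ => ⟨g.1, g.2, h⟩, fun ⟨g, hg, h⟩ => ⟨⟨g, hg⟩, h⟩⟩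

/-- Closedness in terms of finite approximations. -/
theorem isClosedSubgroup_iff {G : Subgroup (Perm Ω)} : IsClosedSubgroup G ↔
    ∀ f : Perm Ω, (∀ T : Set Ω, T.Finite → ∃ g ∈ G, ∀ α ∈ T, g α = f α) → f ∈ G := by
  let _ := functionTopology Ω
  have hopen : ∀ (f : Perm Ω) (T : Set Ω), T.Finite → IsOpen {g : Perm Ω | ∀ α ∈ T, g α = f α} := by
    intro f T hT
    have : {g : Perm Ω | ∀ α ∈ T, g α = f α} = ⋂ α ∈ T, {g : Perm Ω | g α = f α} := by
      ext; simp
    rw [this]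
    exact hT.isOpen_biInter fun α _ => TopologicalSpace.isOpen_generateFrom_of_mem ⟨α, f α, rfl⟩
  constructor
  · intro hG f hf
    by_contra hfG
    have hO : IsOpen ((G : Set (Perm Ω))ᶜ) := isOpen_compl_iff.mpr hG
    have key : ∀ O : Set (Perm Ω), TopologicalSpace.GenerateOpen
        {s | ∃ α β : Ω, s = {f : Perm Ω | f α = β}} O → f ∈ O →
        ∃ T : Set Ω, T.Finite ∧ {g : Perm Ω | ∀ α ∈ T, g α = f α} ⊆ O := by
      intro O hO
      induction hO with
      | basic s hs =>
        obtain ⟨α, β, rfl⟩ := hs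
        intro h
        refine ⟨{α}, finite_singleton α, fun g hg => ?_⟩
        exact (hg α rfl).trans h
      | univ => exact fun _ => ⟨∅, finite_empty, subset_univ _⟩
      | inter s t _ _ ihs iht =>
        rintro ⟨h1, h2⟩
        obtain ⟨T1, hT1, h1⟩ := ihs h1
        obtain ⟨T2, hT2, h2⟩ := iht h2
        exact ⟨T1 ∪ T2, hT1.union hT2, fun g hg =>
          ⟨h1 fun α hα => hg α (Or.inl hα), h2 fun α hα => hg α (Or.inr hα)⟩⟩
      | sUnion S _ ih =>
        rintro ⟨s, hs, hfs⟩
        obtain ⟨T, hT, h⟩ := ih s hs hfs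
        exact ⟨T, hT, h.trans (subset_sUnion_of_mem hs)⟩
    obtain ⟨T, hT, h⟩ := key _ hO hfG
    obtain ⟨g, hg, hgf⟩ := hf T hT
    exact h hgf hg
  · intro h
    refine isOpen_compl_iff.mp (isOpen_iff_forall_mem_open.mpr fun f hf => ?_)
    have : ¬ ∀ T : Set Ω, T.Finite → ∃ g ∈ G, ∀ α ∈ T, g α = f α := fun h' => hf (h f h')
    push Not at this
    obtain ⟨T, hT, h'⟩ := this
    refine ⟨_, fun g hg hgG => ?_, hopen f T hT, fun α _ => rfl⟩
    obtain ⟨α, hα, hne⟩ := h' g hgG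
    exact hne (hg α hα)

/-- A sequence in a closed group which converges pointwise together with its inverses has its
limit in the group. -/
theorem IsClosedSubgroup.exists_limit {G : Subgroup (Perm Ω)} (hG : IsClosedSubgroup G)
    (g : ℕ → Perm Ω) (hg : ∀ n, g n ∈ G)
    (h : ∀ x, ∃ N, ∀ n ≥ N, g n x = g N x)
    (h' : ∀ x, ∃ N, ∀ n ≥ N, (g n)⁻¹ x = (g N)⁻¹ x) :
    ∃ f ∈ G, ∀ x, ∃ N, ∀ n ≥ N, g n x = f x := by
  choose N hN using h
  choose N' hN' using h'
  -- Convergence of the inverses is what makes the pointwise limit surjective.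
  let f : Perm Ω :=
    { toFun := fun x => g (N x) x
      invFun := fun x => (g (N' x))⁻¹ x
      left_inv := fun x => by
        have h1 := hN x (max (N x) (N' (g (N x) x))) (le_max_left _ _)
        have h2 := hN' (g (N x) x) (max (N x) (N' (g (N x) x))) (le_max_right _ _)
        change (g (N' (g (N x) x)))⁻¹ (g (N x) x) = x
        rw [← h2, Perm.inv_eq_iff_eq, h1]
      right_inv := fun x => by
        have h1 := hN ((g (N' x))⁻¹ x) (max (N' x) (N ((g (N' x))⁻¹ x))) (le_max_right _ _)
        have h2 := hN' x (max (N' x) (N ((g (N' x))⁻¹ x))) (le_max_left _ _)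
        change g (N ((g (N' x))⁻¹ x)) ((g (N' x))⁻¹ x) = x
        rw [← h1, ← Perm.eq_inv_iff_eq, h2] }
  have hf : ∀ x, ∃ N, ∀ n ≥ N, g n x = f x := fun x => ⟨N x, hN x⟩
  refine ⟨f, isClosedSubgroup_iff.mp hG f fun T hT => ?_, hf⟩
  obtain ⟨n, hn⟩ : ∃ n, ∀ α ∈ T, N α ≤ n := by
    obtain ⟨n, hn⟩ := (hT.image N).bddAbove
    exact ⟨n, fun α hα => hn ⟨α, hα, rfl⟩⟩
  exact ⟨g n, hg n, fun α hα => hN α n (hn α hα)⟩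

end Closed

/-! ### Countable sets of permutations and stabilizers of finite sets -/

section Generation

variable {Ω : Type*}

theorem exists_perm_comp_eq_of_infinite [Countable Ω] {κ : Type*} (c c' : Ω → κ)
    (h : ∀ k, {x | c x = k}.Infinite) (h' : ∀ k, {x | c' x = k}.Infinite) :
    ∃ σ : Perm Ω, ∀ x, c' (σ x) = c x :=
  exists_perm_comp_eq c c' fun k => by
    have := (h k).to_subtype
    have := (h' k).to_subtype
    exact nonempty_equiv_of_countable (α := {x | c x = k}) (β := {x | c' x = k})

/-- The group of permutations supported in `A`. -/
def symOn (A : Set Ω) : Subgroup (Perm Ω) where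
  carrier := {f | ∀ x ∉ A, f x = x}
  one_mem' := fun _ _ => rfl
  mul_mem' := fun {f g} hf hg x hx => by rw [Perm.mul_apply, hg x hx, hf x hx]
  inv_mem' := fun {f} hf x hx => by rw [Perm.inv_eq_iff_eq, hf x hx]

/-- The full symmetric group is finitely generated over the permutations supported in a set
which is infinite with infinite complement. -/
theorem le_symOn [Countable Ω] {A : Set Ω} (hA : A.Infinite) (hA' : Aᶜ.Infinite) :
    Le ⊤ (symOn A) := by
  classical
  have := hA.to_subtype
  have := hA'.to_subtype
  obtain ⟨E⟩ := nonempty_equiv_of_countable (α := ↥(Aᶜ)) (β := A)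
  obtain ⟨σ, hσ⟩ := exists_perm_extending (fun x : ↥(Aᶜ) => (x : Ω)) (fun x => (E x : Ω))
    Subtype.val_injective (Subtype.val_injective.comp E.injective)
    (by rwa [Subtype.range_coe, compl_compl])
    (by
      have : range (fun x : ↥(Aᶜ) => (E x : Ω)) = A := by
        ext x
        exact ⟨fun ⟨y, hy⟩ => hy ▸ (E y).2, fun hx => ⟨E.symm ⟨x, hx⟩, by simp⟩⟩
      rwa [this])
  have hσ' : ∀ x ∉ A, σ x ∈ A := fun x hx => by
    rw [hσ ⟨x, hx⟩]; exact (E ⟨x, hx⟩).2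
  have hprop : ∀ (B : Set Ω), B.Infinite → Bᶜ.Infinite → ∀ k, {x | (x ∈ B) = k}.Infinite := by
    intro B hB hB' k
    by_cases hk : k
    · refine hB.mono fun x hx => ?_
      simpa [hk] using hx
    · refine hB'.mono fun x hx => ?_
      simpa [hk] using hx
  have hprop2 : ∀ (B : Set Ω), (∀ k : Prop, {x | (x ∈ A ↔ k) ∧ x ∈ B}.Infinite) →
      (∀ k : Prop, {x | (x ∈ A ↔ k) ∧ x ∉ B}.Infinite) →
      ∀ k : Prop × Prop, {x | ((x ∈ A : Prop), (x ∈ B : Prop)) = k}.Infinite := by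
    rintro B hB hB' ⟨k, l⟩
    by_cases hl : l
    · refine (hB k).mono fun x hx => ?_
      simpa [hl] using hx
    · refine (hB' k).mono fun x hx => ?_
      simpa [hl] using hx
  have hAk : ∀ k : Prop, {x | x ∈ A ↔ k}.Infinite := by
    intro k
    by_cases hk : k
    · simpa [hk] using hA
    · simpa [hk, Set.compl_def] using hA'
  obtain ⟨h₀, hh₀⟩ := exists_splitting (fun k : Prop => {x | x ∈ A ↔ k}) hAk
  -- `C₀` cuts both `A` and its complement into two infinite parts. Any two sets with this property
  -- are exchanged by a permutation preserving `A`.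
  let C₀ : Set Ω := {x | h₀ x = 0}
  have hC₀ : ∀ k : Prop, {x | (x ∈ A ↔ k) ∧ x ∈ C₀}.Infinite := fun k => hh₀ k 0
  have hC₀' : ∀ k : Prop, {x | (x ∈ A ↔ k) ∧ x ∉ C₀}.Infinite := fun k =>
    (hh₀ k 1).mono fun x hx => ⟨hx.1, by simp [C₀, hx.2]⟩
  obtain ⟨y, hy⟩ := exists_perm_comp_eq_of_infinite (fun x => (x ∈ A : Prop))
    (fun x => (x ∈ C₀ : Prop)) (hprop A hA hA')
    (hprop C₀ ((hC₀ True).mono fun x hx => hx.2) ((hC₀' True).mono fun x hx => hx.2))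
  refine ⟨{σ, y}, by simp, ?_⟩
  set H := Subgroup.closure ((symOn A : Set (Perm Ω)) ∪ {σ, y}) with hH
  have hAH : symOn A ≤ H := le_closure_union_left _ _
  have hσH : σ ∈ H := Subgroup.subset_closure (by simp)
  have hyH : y ∈ H := Subgroup.subset_closure (by simp)
  -- `σ` carries the complement of `A` into `A`. Both halves being available, every permutation
  -- preserving `A` setwise lies in `H`.
  have hA'H : symOn Aᶜ ≤ H := by
    intro f hf
    have : σ * f * σ⁻¹ ∈ symOn A := by
      intro x hx
      have : σ⁻¹ x ∉ Aᶜ := fun h => hx (by simpa using hσ' _ h)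
      rw [Perm.mul_apply, Perm.mul_apply, hf _ this]; simp
    have := H.mul_mem (H.mul_mem (H.inv_mem hσH) (hAH this)) hσH
    simpa [mul_assoc] using this
  have hN : ∀ n : Perm Ω, (∀ x, n x ∈ A ↔ x ∈ A) → n ∈ H := by
    intro n hn
    let n' : Perm Ω := Perm.ofSubtype (Perm.subtypePerm n (p := (· ∈ A)) (fun x => (hn x)))
    have h1 : ∀ x ∈ A, n' x = n x := fun x hx => by
      rw [Perm.ofSubtype_apply_of_mem _ hx]; rfl
    have h2 : n' ∈ symOn A := fun x hx => Perm.ofSubtype_apply_of_not_mem _ hx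
    have h3 : n'⁻¹ * n ∈ symOn Aᶜ := by
      intro x hx
      rw [Perm.mul_apply, Perm.inv_eq_iff_eq, h1 x (by simpa using hx)]
    have := H.mul_mem (hAH h2) (hA'H h3)
    simpa using this
  intro f _
  have hfk : ∀ k : Prop, {x | f x ∈ A ↔ k}.Infinite := fun k => by
    have : {x | f x ∈ A ↔ k} = f ⁻¹' {x | x ∈ A ↔ k} := rfl
    rw [this, ← Equiv.image_symm_eq_preimage]
    exact (hAk k).image f.symm.injective.injOn
  -- This gives a set `C` such that `C` and its image `C'` under `f` both cut `A` and its complement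
  -- into infinite parts. With `n` taking `C₀` to `C` and `n'` taking `C'` to `C₀`, the product `n'
  -- * f * n` preserves `C₀`, and `y` transports this to `A`.
  obtain ⟨h, hh⟩ := exists_splitting
    (fun k : Prop ⊕ Prop => Sum.elim (fun k => {x | x ∈ A ↔ k}) (fun k => {x | f x ∈ A ↔ k}) k)
    (by rintro (k | k); exacts [hAk k, hfk k])
  let C : Set Ω := {x | h x = 0}
  let C' : Set Ω := {x | h (f⁻¹ x) = 0}
  have himg : ∀ (k : Prop) (j : ℕ), {x | (x ∈ A ↔ k) ∧ h (f⁻¹ x) = j}.Infinite := by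
    intro k j
    refine ((hh (Sum.inr k) j).image f.injective.injOn).mono ?_
    rintro _ ⟨x, ⟨hx1, hx2⟩, rfl⟩
    exact ⟨hx1, by simpa using hx2⟩
  obtain ⟨n, hn⟩ := exists_perm_comp_eq_of_infinite
    (fun x => ((x ∈ A : Prop), (x ∈ C₀ : Prop))) (fun x => ((x ∈ A : Prop), (x ∈ C : Prop)))
    (hprop2 C₀ hC₀ hC₀')
    (hprop2 C (fun k => hh (Sum.inl k) 0)
      (fun k => (hh (Sum.inl k) 1).mono fun x hx => ⟨hx.1, by simp [C, hx.2]⟩))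
  obtain ⟨n', hn'⟩ := exists_perm_comp_eq_of_infinite
    (fun x => ((x ∈ A : Prop), (x ∈ C' : Prop))) (fun x => ((x ∈ A : Prop), (x ∈ C₀ : Prop)))
    (hprop2 C' (fun k => himg k 0)
      (fun k => (himg k 1).mono fun x hx => ⟨hx.1, fun h0 => by simpa using hx.2.symm.trans h0⟩))
    (hprop2 C₀ hC₀ hC₀')
  simp only [Prod.mk.injEq, eq_iff_iff] at hn hn' hy
  have hm : y⁻¹ * n' * f * n * y ∈ H := by
    refine hN _ fun x => ?_
    rw [← hy x, ← (hn (y x)).2, ← hy]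
    have : n (y x) ∈ C ↔ f (n (y x)) ∈ C' := by simp [C, C']
    rw [this, ← (hn' _).2]
    simp
  have hnH := hN n fun x => (hn x).1
  have hnH' := hN n' fun x => (hn' x).1
  have := H.mul_mem (H.mul_mem (H.mul_mem (H.mul_mem (H.inv_mem hnH') hyH) hm)
    (H.inv_mem hyH)) (H.inv_mem hnH)
  simpa [mul_assoc] using this

/-- A word uses only finitely many letters; countability suffices for reducing countable sets to a
moiety. -/
theorem mem_closure_countable_subset {G : Type*} [Group G] {S : Set G} {g : G}
    (h : g ∈ Subgroup.closure S) : ∃ W ⊆ S, W.Countable ∧ g ∈ Subgroup.closure W := by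
  induction h using Subgroup.closure_induction with
  | mem x hx => exact ⟨{x}, by simpa using hx, countable_singleton x,
      Subgroup.subset_closure rfl⟩
  | one => exact ⟨∅, empty_subset _, countable_empty, Subgroup.one_mem _⟩
  | mul x y _ _ hx hy =>
    obtain ⟨W, hW, hWc, hx⟩ := hx
    obtain ⟨W', hW', hWc', hy⟩ := hy
    exact ⟨W ∪ W', union_subset hW hW', hWc.union hWc', Subgroup.mul_mem _
      (Subgroup.closure_mono subset_union_left hx)
      (Subgroup.closure_mono subset_union_right hy)⟩
  | inv x _ hx =>
    obtain ⟨W, hW, hWc, hx⟩ := hx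
    exact ⟨W, hW, hWc, Subgroup.inv_mem _ hx⟩

/-- Countably many permutations supported in a suitable moiety lie in a finitely generated
group. -/
theorem exists_moiety_countable_subset_closure [Countable Ω] [Infinite Ω] :
    ∃ A : Set Ω, A.Infinite ∧ Aᶜ.Infinite ∧ ∀ f : ℕ → Perm Ω, (∀ k, f k ∈ symOn A) →
      ∃ U : Set (Perm Ω), U.Finite ∧ ∀ k, f k ∈ Subgroup.closure U := by
  classical
  obtain ⟨e⟩ := nonempty_equiv_of_countable (α := ℕ × ℤ × ℤ) (β := Ω)
  let ρ : Perm (ℕ × ℤ × ℤ) →* Perm Ω := (Perm.viaEmbeddingHom e.toEmbedding)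
  have hρ : ∀ p x, ρ p (e x) = e (p x) := fun p x => Perm.viaEmbedding_apply p e.toEmbedding x
  let A : Set Ω := range fun n : ℕ => e (n, 0, 0)
  refine ⟨A, infinite_range_of_injective fun m n h => by simpa using h, ?_, fun f hf => ?_⟩
  · refine Set.infinite_of_injective_forall_mem (f := fun n : ℕ => e (n, 1, 0))
      (fun m n h => by simpa using h) ?_
    rintro n ⟨m, hm⟩
    simp at hm
  have hfA : ∀ k n, ∃ m, f k (e (n, 0, 0)) = e (m, 0, 0) := by
    intro k n
    by_contra h
    have h1 : f k (e (n, 0, 0)) ∉ A := fun ⟨m, hm⟩ => h ⟨m, hm.symm⟩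
    have h2 := hf k _ h1
    exact h ⟨n, (f k).injective h2⟩
  have hfA' : ∀ k n, ∃ m, (f k)⁻¹ (e (n, 0, 0)) = e (m, 0, 0) := by
    intro k n
    by_contra h
    have h1 : (f k)⁻¹ (e (n, 0, 0)) ∉ A := fun ⟨m, hm⟩ => h ⟨m, hm.symm⟩
    have h2 := (symOn A).inv_mem (hf k) _ h1
    exact h ⟨n, (f k)⁻¹.injective h2⟩
  choose a ha using hfA
  choose b hb using hfA'
  let g : ℕ → Perm ℕ := fun k =>
    { toFun := a k
      invFun := b k
      left_inv := fun n => by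
        have : e (b k (a k n), 0, 0) = e (n, 0, 0) := by
          rw [← hb, ← ha, Perm.inv_eq_iff_eq]
        simpa using this
      right_inv := fun n => by
        have : e (a k (b k n), 0, 0) = e (n, 0, 0) := by
          rw [← ha, ← Perm.eq_inv_iff_eq, ← hb]
        simpa using this }
  have hg : ∀ k n, f k (e (n, 0, 0)) = e (g k n, 0, 0) := ha
  -- Over the cell `(i, j)`, `φ` acts as `g j.toNat` if `0 ≤ i` and trivially otherwise. It stores
  -- all the permutations at once; `w` shifts rows and `u` shifts along row `0` only.
  let φ : Perm (ℕ × ℤ × ℤ) :=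
    { toFun := fun p => (if 0 ≤ p.2.1 then g p.2.2.toNat p.1 else p.1, p.2)
      invFun := fun p => (if 0 ≤ p.2.1 then (g p.2.2.toNat)⁻¹ p.1 else p.1, p.2)
      left_inv := fun p => by
        ext <;> dsimp only
        split_ifs <;> simp
      right_inv := fun p => by
        ext <;> dsimp only
        split_ifs <;> simp }
  let u : Perm (ℕ × ℤ × ℤ) :=
    { toFun := fun p => (p.1, if p.2.2 = 0 then p.2.1 + 1 else p.2.1, p.2.2)
      invFun := fun p => (p.1, if p.2.2 = 0 then p.2.1 - 1 else p.2.1, p.2.2)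
      left_inv := fun p => by
        ext <;> dsimp only
        split_ifs <;> simp
      right_inv := fun p => by
        ext <;> dsimp only
        split_ifs <;> simp }
  let w : ℕ → Perm (ℕ × ℤ × ℤ) := fun k =>
    { toFun := fun p => (p.1, p.2.1, p.2.2 + k)
      invFun := fun p => (p.1, p.2.1, p.2.2 - k)
      left_inv := fun p => by simp
      right_inv := fun p => by simp }
  have hw : ∀ k, w k = (w 1) ^ k := by
    intro k
    induction k with
    | zero => ext p <;> simp [w]
    | succ k ih =>
      rw [pow_succ, ← ih]
      ext p <;> simp [w]
      ring
  refine ⟨{ρ φ, ρ u, ρ (w 1)}, by simp, fun k => ?_⟩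
  set H := Subgroup.closure ({ρ φ, ρ u, ρ (w 1)} : Set (Perm Ω))
  have hφH : ρ φ ∈ H := Subgroup.subset_closure (by simp)
  have huH : ρ u ∈ H := Subgroup.subset_closure (by simp)
  have hwH : ρ (w k) ∈ H := by
    rw [hw, map_pow]
    exact H.pow_mem (Subgroup.subset_closure (by simp)) k
  -- Row `0` of `ψ` carries `g k` on the cells `i ≥ 0`. In the commutator with `u` these copies
  -- cancel except at `i = 0`, and the rows fixed by `u` contribute nothing.
  let ψ := (w k)⁻¹ * φ * w k
  have hψH : ρ ψ ∈ H := by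
    simp only [ψ, map_mul, map_inv]
    exact H.mul_mem (H.mul_mem (H.inv_mem hwH) hφH) hwH
  have hcH : ρ (ψ * u * ψ⁻¹ * u⁻¹) ∈ H := by
    simp only [map_mul, map_inv]
    exact H.mul_mem (H.mul_mem (H.mul_mem hψH huH) (H.inv_mem hψH)) (H.inv_mem huH)
  convert hcH
  have hψ : ∀ n i j, ψ (n, i, j) = (if 0 ≤ i then g (j + k).toNat n else n, i, j) := by
    intro n i j
    simp only [ψ, Perm.mul_apply]
    rw [Perm.inv_eq_iff_eq]
    rfl
  have hψ' : ∀ n i j, ψ⁻¹ (n, i, j) = (if 0 ≤ i then (g (j + k).toNat)⁻¹ n else n, i, j) := by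
    intro n i j
    rw [Perm.inv_eq_iff_eq, hψ]
    split_ifs <;> simp
  have hu : ∀ n i j, u (n, i, j) = (n, if j = 0 then i + 1 else i, j) := fun _ _ _ => rfl
  have hu' : ∀ n i j, u⁻¹ (n, i, j) = (n, if j = 0 then i - 1 else i, j) := fun _ _ _ => rfl
  ext x
  obtain ⟨⟨n, i, j⟩, rfl⟩ := e.surjective x
  rw [hρ]
  simp only [Perm.mul_apply]
  by_cases hij : i = 0 ∧ j = 0
  · obtain ⟨rfl, rfl⟩ := hij
    rw [hg, hu', hψ', hu, hψ]
    simp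
  · have hx : e (n, i, j) ∉ A := by
      rintro ⟨m, hm⟩
      simp only [EmbeddingLike.apply_eq_iff_eq, Prod.mk.injEq] at hm
      exact hij ⟨hm.2.1.symm, hm.2.2.symm⟩
    rw [hf k _ hx, hu', hψ', hu, hψ]
    by_cases hj : j = 0
    · subst hj
      have hi : i ≠ 0 := fun h => hij ⟨h, rfl⟩
      by_cases h0 : 0 ≤ i
      · have h1 : 1 ≤ i := by omega
        simp [h0, h1]
      · have h1 : ¬ 1 ≤ i := by omega
        simp [h0, h1]
    · by_cases h0 : 0 ≤ i <;> simp [hj, h0]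

/-- Every countable set of permutations lies in a finitely generated group (Galvin). -/
theorem exists_finite_closure_of_countable [Countable Ω] [Infinite Ω] {V : Set (Perm Ω)}
    (hV : V.Countable) : ∃ U : Set (Perm Ω), U.Finite ∧ V ⊆ Subgroup.closure U := by
  obtain ⟨A, hA, hA', hgal⟩ := exists_moiety_countable_subset_closure (Ω := Ω)
  obtain ⟨U, hU, htop⟩ := le_symOn hA hA'
  have : ∀ v : Perm Ω, ∃ W ⊆ (symOn A : Set (Perm Ω)) ∪ U, W.Countable ∧
      v ∈ Subgroup.closure W := fun v => mem_closure_countable_subset (htop (Subgroup.mem_top v))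
  choose W hW hWc hvW using this
  have hc : ((⋃ v ∈ V, W v) ∩ symOn A).Countable := (hV.biUnion fun v _ => hWc v).mono inter_subset_left
  obtain ⟨f, hf⟩ := (hc.insert 1).exists_eq_range (insert_nonempty _ _)
  obtain ⟨U', hU', hfU⟩ := hgal f fun k => by
    have : f k ∈ insert 1 ((⋃ v ∈ V, W v) ∩ symOn A) := hf ▸ mem_range_self k
    rcases this with h | h
    · rw [h]; exact (symOn A).one_mem
    · exact h.2
  refine ⟨U' ∪ U, hU'.union hU, fun v hv => ?_⟩
  refine (Subgroup.closure_le _).mpr ?_ (hvW v)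
  intro x hx
  rcases hW v hx with h | h
  · have : x ∈ range f := hf ▸ Or.inr ⟨mem_biUnion hv hx, h⟩
    obtain ⟨k, rfl⟩ := this
    exact Subgroup.closure_mono subset_union_left (hfU k)
  · exact Subgroup.subset_closure (Or.inr h)

theorem Le.of_countable [Countable Ω] [Infinite Ω] {G H : Subgroup (Perm Ω)}
    {V : Set (Perm Ω)} (hV : V.Countable)
    (h : G ≤ Subgroup.closure ((H : Set (Perm Ω)) ∪ V)) : Le G H := by
  obtain ⟨U, hU, hVU⟩ := exists_finite_closure_of_countable hV
  refine ⟨U, hU, h.trans ((Subgroup.closure_le _).mpr ?_)⟩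
  rintro x (hx | hx)
  · exact Subgroup.subset_closure (Or.inl hx)
  · exact Subgroup.closure_mono subset_union_right (hVU hx)

/-- A group is finitely generated over its stabilizers of finite sets. -/
theorem le_pointwiseStabilizer [Countable Ω] [Infinite Ω] (G : Subgroup (Perm Ω)) {T : Set Ω}
    (hT : T.Finite) : Le G (pointwiseStabilizer G T) := by
  classical
  have := hT.to_subtype
  -- Restriction to `T` determines the coset of the stabilizer, and `s` picks representatives. Since
  -- `T` is finite there are only countably many restrictions.
  let r : G → (T → Ω) := fun g t => g.1 t
  let s : (T → Ω) → Perm Ω := fun v => if h : ∃ g, r g = v then (h.choose : Perm Ω) else 1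
  have hs : ∀ g : G, s (r g) ∈ G ∧ ∀ t ∈ T, s (r g) t = g.1 t := by
    intro g
    have h : ∃ g', r g' = r g := ⟨g, rfl⟩
    have hsr : s (r g) = h.choose := dif_pos h
    rw [hsr]
    exact ⟨h.choose.2, fun t ht => congrFun h.choose_spec ⟨t, ht⟩⟩
  refine Le.of_countable (countable_range s) fun g hg => ?_
  have h1 := hs ⟨g, hg⟩
  have h2 : (s (r ⟨g, hg⟩))⁻¹ * g ∈ pointwiseStabilizer G T :=
    ⟨G.mul_mem (G.inv_mem h1.1) hg, fun t ht => by
      rw [Perm.mul_apply, Perm.inv_eq_iff_eq, h1.2 t ht]⟩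
  have h3 : s (r ⟨g, hg⟩) ∈
      Subgroup.closure ((pointwiseStabilizer G T : Set (Perm Ω)) ∪ range s) :=
    Subgroup.subset_closure (Or.inr (mem_range_self _))
  have := Subgroup.mul_mem _ h3 (le_closure_union_left _ (range s) h2)
  simpa using this

end Generation

/-! ### Convergent trees in a closed group -/

section Tree

variable {Ω : Type*}

/-- The points fixed by all extensions of node `n`: for `i < n` the points `(F i).2`, `e i` and
the preimages of `e i` under the group elements `(F M).1` of the nodes `M ≤ n`. -/
def frozen (e : ℕ → Ω) (F : ℕ → Perm Ω × Ω) (n : ℕ) : Set Ω :=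
  {x | ∃ i < n, x = (F i).2 ∨ x = e i ∨ ∃ M ≤ n, x = (F M).1⁻¹ (e i)}

theorem frozen_finite (e : ℕ → Ω) (F : ℕ → Perm Ω × Ω) (n : ℕ) : (frozen e F n).Finite := by
  have : frozen e F n ⊆ ((fun i => (F i).2) '' Iio n) ∪ (e '' Iio n) ∪
      ((fun p : ℕ × ℕ => (F p.1).1⁻¹ (e p.2)) '' (Iic n ×ˢ Iio n)) := by
    rintro x ⟨i, hi, rfl | rfl | ⟨M, hM, rfl⟩⟩
    · exact Or.inl (Or.inl ⟨i, hi, rfl⟩)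
    · exact Or.inl (Or.inr ⟨i, hi, rfl⟩)
    · exact Or.inr ⟨(M, i), ⟨hM, hi⟩, rfl⟩
  exact ((((finite_Iio n).image _).union ((finite_Iio n).image _)).union
    (((finite_Iic n).prod (finite_Iio n)).image _)).subset this

theorem frozen_mono (e : ℕ → Ω) (F : ℕ → Perm Ω × Ω) {m n : ℕ} (h : m ≤ n) :
    frozen e F m ⊆ frozen e F n := by
  rintro x ⟨i, hi, hx⟩
  refine ⟨i, hi.trans_le h, hx.imp id (Or.imp id ?_)⟩
  rintro ⟨M, hM, hx⟩
  exact ⟨M, hM.trans h, hx⟩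

/-- The point of node `n` does not enter, so it can be chosen after the group element of that node.
-/
theorem frozen_congr (e : ℕ → Ω) {F F' : ℕ → Perm Ω × Ω} {n : ℕ} (h : ∀ m < n, F m = F' m)
    (h' : (F n).1 = (F' n).1) : frozen e F n = frozen e F' n := by
  have h1 : ∀ M ≤ n, (F M).1 = (F' M).1 := fun M hM => by
    rcases hM.lt_or_eq with hM | rfl
    · rw [h M hM]
    · exact h'
  ext x
  refine exists_congr fun i => and_congr_right fun hi => ?_
  rw [h i hi]
  refine or_congr Iff.rfl (or_congr Iff.rfl (exists_congr fun M => and_congr_right fun hM => ?_))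
  rw [h1 M hM]

theorem encard_orbit_of_mem {G : Subgroup (Perm Ω)} {T : Set Ω} {x : Ω} (hx : x ∈ T) :
    (MulAction.orbit (pointwiseStabilizer G T) x).encard = 1 := by
  rw [encard_eq_one]
  refine ⟨x, Subset.antisymm ?_ (by simp)⟩
  rintro _ ⟨g, rfl⟩
  exact g.2.2 x hx

/-- Trees of group elements in a closed group with large orbits. Node `n` extends node `par n`,
its group element agrees with that of `par n` on the first `par n` points `α i`, and the images
of the points `α i` (`par n ≤ i < n`) are new when `adm n i` holds. Along every branch the group
elements converge in the group. -/
theorem exists_tree [Countable Ω] [Nonempty Ω] {G : Subgroup (Perm Ω)} (hG : IsClosedSubgroup G)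
    (par : ℕ → ℕ) (hpar : ∀ n, 0 < n → par n < n) (adm : ℕ → ℕ → Prop)
    (horb : ∀ i, ∀ T : Set Ω, T.Finite → ∃ a : Ω, ∀ N, adm N i →
      ((N * N + 1 : ℕ) : ℕ∞) < (MulAction.orbit (pointwiseStabilizer G T) a).encard) :
    ∃ (α : ℕ → Ω) (γ : ℕ → Perm Ω),
      (∀ i i', (∃ N, adm N i) → (∃ N, adm N i') → α i = α i' → i = i') ∧
      (∀ N i N' i', par N ≤ i → i < N → adm N i → par N' ≤ i' → i' < N' → adm N' i' →
        γ N (α i) = γ N' (α i') → N = N' ∧ i = i') ∧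
      (∀ p : ℕ → ℕ, (∀ k, p k < p (k + 1) ∧ par (p (k + 1)) = p k) →
        ∃ g ∈ G, ∀ k i, i < p k → g (α i) = γ (p k) (α i)) := by
  classical
  obtain ⟨e, he⟩ := exists_surjective_nat Ω
  let P : ℕ → (ℕ → Perm Ω × Ω) → Prop := fun n F =>
    (F n).1 ∈ G ∧
    (0 < n → (F (par n)).1⁻¹ * (F n).1 ∈ pointwiseStabilizer G (frozen e F (par n))) ∧
    (∀ i, par n ≤ i → i < n → adm n i → ∀ M < n, ∀ i' < M,
      (F n).1 (F i).2 ≠ (F M).1 (F i').2) ∧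
    (∀ N, adm N n → ((N * N + 1 : ℕ) : ℕ∞) <
      (MulAction.orbit (pointwiseStabilizer G (frozen e F n)) (F n).2).encard)
  have hcongr : ∀ n F F', (∀ m ≤ n, F m = F' m) → P n F → P n F' := by
    rintro n F F' h ⟨h1, h2, h3, h4⟩
    refine ⟨h n le_rfl ▸ h1, fun hn => ?_, fun i hi hin hadm M hM i' hi' => ?_, fun N hN => ?_⟩
    · have hp := hpar n hn
      rw [← h n le_rfl, ← h _ hp.le,
        ← frozen_congr e (fun m hm => h m (hm.trans hp).le) (by rw [h _ hp.le])]
      exact h2 hn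
    · rw [← h n le_rfl, ← h i hin.le, ← h M hM.le, ← h i' (hi'.trans hM).le]
      exact h3 i hi hin hadm M hM i' hi'
    · rw [← h n le_rfl, ← frozen_congr e (fun m hm => h m hm.le) (by rw [h n le_rfl])]
      exact h4 N hN
  have hstep : ∀ n F, (∀ m < n, P m F) → ∃ x, P n (Function.update F n x) := by
    intro n F hF
    obtain ⟨g, hgG, hg1, hg2⟩ : ∃ g ∈ G,
        (0 < n → (F (par n)).1⁻¹ * g ∈ pointwiseStabilizer G (frozen e F (par n))) ∧
        (∀ i, par n ≤ i → i < n → adm n i → ∀ M < n, ∀ i' < M,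
          g (F i).2 ≠ (F M).1 (F i').2) := by
      rcases Nat.eq_zero_or_pos n with rfl | hn
      · exact ⟨1, G.one_mem, fun h => absurd h (lt_irrefl _), fun i _ hi => absurd hi (by omega)⟩
      set j := par n with hj
      have hjn : j < n := hpar n hn
      -- These images are to be avoided. There are at most `n * n` of them, whence the orbit bound
      -- `N * N + 1`; the extra `1` keeps the points distinct even when `N = 0`.
      let B : Finset Ω := (Finset.range n ×ˢ Finset.range n).image
        fun p => (F p.1).1 (F p.2).2
      have hBc : B.card ≤ n * n := Finset.card_image_le.trans (by simp)
      have hB : ∀ M < n, ∀ i' < M, (F M).1 (F i').2 ∈ B := fun M hM i' hi' =>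
        Finset.mem_image.mpr ⟨(M, i'), by simp; omega, rfl⟩
      -- Points are moved one at a time. The correction for point `t` fixes all earlier points,
      -- which are frozen at `t`, so freshness already achieved persists.
      have key : ∀ t, j ≤ t → t ≤ n → ∃ h ∈ pointwiseStabilizer G (frozen e F j),
          ∀ i, j ≤ i → i < t → adm n i → (F j).1 (h (F i).2) ∉ B := by
        intro t hjt
        induction t, hjt using Nat.le_induction with
        | base => exact fun _ => ⟨1, Subgroup.one_mem _, fun i hi hi' => absurd hi (by omega)⟩
        | succ t hjt ih =>
          intro htn
          obtain ⟨h, hh, hfresh⟩ := ih (by omega)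
          obtain ⟨h', hh', hfresh'⟩ : ∃ h' ∈ pointwiseStabilizer G (frozen e F t),
              adm n t → (F j).1 (h (h' (F t).2)) ∉ B := by
            by_cases hadm : adm n t
            · have h1 := (hF t (by omega)).2.2.2 n hadm
              have h2 : ((B.image fun x => h⁻¹ ((F j).1⁻¹ x) : Finset Ω) : Set Ω).encard ≤
                  ((n * n + 1 : ℕ) : ℕ∞) := by
                rw [encard_coe_eq_coe_finsetCard]
                exact_mod_cast Finset.card_image_le.trans (hBc.trans (Nat.le_succ _))
              obtain ⟨b, hb, hb'⟩ := exists_mem_notMem_of_encard_lt (h2.trans_lt h1)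
              obtain ⟨h', hh', rfl⟩ := mem_orbit_iff'.mp hb
              refine ⟨h', hh', fun _ hmem => hb' ?_⟩
              exact Finset.mem_coe.mpr (Finset.mem_image.mpr ⟨_, hmem, by simp⟩)
            · exact ⟨1, Subgroup.one_mem _, fun h => absurd h hadm⟩
          refine ⟨h * h', Subgroup.mul_mem _ hh
            (pointwiseStabilizer_anti G (frozen_mono e F hjt) hh'), fun i hi hit hadm => ?_⟩
          rcases Nat.lt_succ_iff_lt_or_eq.mp hit with hit | rfl
          · rw [Perm.mul_apply, hh'.2 (F i).2 ⟨i, hit, Or.inl rfl⟩]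
            exact hfresh i hi hit hadm
          · exact hfresh' hadm
      obtain ⟨h, hh, hfresh⟩ := key n hjn.le le_rfl
      refine ⟨(F j).1 * h, G.mul_mem (hF j hjn).1 hh.1, fun _ => by simpa using hh,
        fun i hi hin hadm M hM i' hi' heq => ?_⟩
      refine hfresh i hi hin hadm ?_
      rw [← Perm.mul_apply, heq]
      exact hB M hM i' hi'
    let T := frozen e (Function.update F n (g, Classical.arbitrary Ω)) n
    obtain ⟨a, ha⟩ := horb n T (frozen_finite e _ n)
    refine ⟨(g, a), ?_, fun hn => ?_, fun i hi hin hadm M hM i' hi' => ?_, fun N hN => ?_⟩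
    · simpa using hgG
    · have hp := hpar n hn
      rw [Function.update_self, Function.update_of_ne hp.ne]
      rw [frozen_congr e (F' := F) (fun m hm => Function.update_of_ne (hm.trans hp).ne _ _)
        (by rw [Function.update_of_ne hp.ne])]
      exact hg1 hn
    · rw [Function.update_self, Function.update_of_ne hin.ne, Function.update_of_ne hM.ne,
        Function.update_of_ne (hi'.trans hM).ne]
      exact hg2 i hi hin hadm M hM i' hi'
    · rw [Function.update_self]
      have : frozen e (Function.update F n (g, a)) n = T := frozen_congr e
        (fun m hm => by rw [Function.update_of_ne hm.ne, Function.update_of_ne hm.ne])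
        (by rw [Function.update_self, Function.update_self])
      rw [this]
      exact ha N hN
  obtain ⟨F, hF⟩ := exists_seq_of_forall_extend P hcongr hstep
  have hα : ∀ i i', i' < i → (∃ N, adm N i) → (F i).2 ≠ (F i').2 := by
    rintro i i' hi ⟨N, hN⟩ heq
    have h1 := (hF i).2.2.2 N hN
    rw [encard_orbit_of_mem (T := frozen e F i) ⟨i', hi, Or.inl heq⟩] at h1
    have : N * N + 1 < 1 := by exact_mod_cast h1
    omega
  have hinj : ∀ i i', (∃ N, adm N i) → (∃ N, adm N i') → (F i).2 = (F i').2 → i = i' := by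
    intro i i' h h' heq
    rcases lt_trichotomy i i' with hlt | h | hlt
    · exact absurd heq.symm (hα i' i hlt h')
    · exact h
    · exact absurd heq (hα i i' hlt h)
  refine ⟨fun i => (F i).2, fun n => (F n).1, hinj, ?_, ?_⟩
  · intro N i N' i' hi hiN hadm hi' hiN' hadm' heq
    rcases lt_trichotomy N N' with hlt | rfl | hlt
    · exact absurd heq.symm ((hF N').2.2.1 i' hi' hiN' hadm' N hlt i hiN)
    · exact ⟨rfl, hinj i i' ⟨_, hadm⟩ ⟨_, hadm'⟩ ((F N).1.injective heq)⟩
    · exact absurd heq ((hF N).2.2.1 i hi hiN hadm N' hlt i' hiN')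
  · intro p hp
    have hmono : StrictMono p := strictMono_nat_of_lt_succ fun k => (hp k).1
    have hstab : ∀ k, ∀ x ∈ frozen e F (p k), (F (p (k + 1))).1 x = (F (p k)).1 x := by
      intro k x hx
      have := (hF (p (k + 1))).2.1 (by have := (hp k).1; omega)
      rw [(hp k).2] at this
      have h2 := this.2 x hx
      rwa [Perm.mul_apply, Perm.inv_eq_iff_eq] at h2
    have hstab' : ∀ k, ∀ x ∈ frozen e F (p k), ∀ l ≥ k, (F (p l)).1 x = (F (p k)).1 x := by
      intro k x hx l hl
      induction l, hl using Nat.le_induction with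
      | base => rfl
      | succ l hl ih => rw [hstab l x (frozen_mono e F (hmono.monotone hl) hx), ih]
    -- Freezing each `e i` makes its images settle along the branch; freezing its preimages makes
    -- the inverses settle.
    obtain ⟨g, hgG, hg⟩ := hG.exists_limit (fun k => (F (p k)).1) (fun k => (hF _).1)
      (fun x => by
        obtain ⟨i, rfl⟩ := he x
        exact ⟨i + 1, hstab' (i + 1) _ ⟨i, hmono.le_apply (x := i + 1), Or.inr (Or.inl rfl)⟩⟩)
      (fun x => by
        obtain ⟨i, rfl⟩ := he x
        refine ⟨i + 1, fun l hl => ?_⟩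
        induction l, hl using Nat.le_induction with
        | base => rfl
        | succ l hl ih =>
          rw [← ih, Perm.inv_eq_iff_eq, hstab l _ ⟨i, (Nat.lt_of_succ_le hl).trans_le
            hmono.le_apply, Or.inr (Or.inr ⟨p l, le_rfl, rfl⟩)⟩]
          simp)
    refine ⟨g, hgG, fun k i hi => ?_⟩
    obtain ⟨N, hN⟩ := hg (F i).2
    rw [← hN (max N k) (le_max_left _ _)]
    exact hstab' k _ ⟨i, hi, Or.inl rfl⟩ _ (le_max_right _ _)

end Tree

/-! ### Block permutations and their realization -/

section Blocks

/-- The permutations preserving each fiber of `b`. -/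
def blockGroup {X ι : Type*} (b : X → ι) : Subgroup (Perm X) where
  carrier := {f | ∀ x, b (f x) = b x}
  one_mem' := fun _ => rfl
  mul_mem' := fun {f g} hf hg x => by rw [Perm.mul_apply, hf, hg]
  inv_mem' := fun {f} hf x => by
    have := hf (f⁻¹ x)
    simpa using this.symm

/-- A set partitioned into blocks of sizes `d 0, d 1, …`. -/
abbrev Blocks (d : ℕ → ℕ) := Σ k, Fin (d k)

variable {Ω : Type*}

/-- The copy along `e` of the group of permutations preserving all blocks. -/
noncomputable def blockCopy {d : ℕ → ℕ} (e : Blocks d ↪ Ω) : Subgroup (Perm Ω) :=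
  (blockGroup (Sigma.fst : Blocks d → ℕ)).map (Perm.viaEmbeddingHom e)

theorem mem_blockCopy {d : ℕ → ℕ} {e : Blocks d ↪ Ω} {f : Perm Ω} :
    f ∈ blockCopy e ↔ ∃ ψ ∈ blockGroup (Sigma.fst : Blocks d → ℕ), ψ.viaEmbedding e = f := Iff.rfl

theorem exists_family_of_mem_blockGroup {d : ℕ → ℕ} {ψ : Perm (Blocks d)}
    (hψ : ψ ∈ blockGroup (Sigma.fst : Blocks d → ℕ)) :
    ∃ f : ∀ k, Perm (Fin (d k)), ∀ k i, ψ ⟨k, i⟩ = ⟨k, f k i⟩ := by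
  have : ∀ k i, ∃ j : Fin (d k), ψ ⟨k, i⟩ = ⟨k, j⟩ := by
    intro k i
    have := hψ ⟨k, i⟩
    generalize ψ ⟨k, i⟩ = y at this
    obtain ⟨k', j⟩ := y
    obtain rfl : k' = k := this
    exact ⟨j, rfl⟩
  choose F hF using this
  have hinj : ∀ k, Function.Injective (F k) := fun k i j hij => by
    have : ψ ⟨k, i⟩ = ψ ⟨k, j⟩ := by rw [hF, hF, hij]
    simpa using this
  exact ⟨fun k => Equiv.ofBijective (F k) (Finite.injective_iff_bijective.mp (hinj k)), hF⟩

/-- `G` realizes all block permutations on a set of blocks of sizes `d`, as restrictions of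
conjugates of a single permutation. -/
def Realizes (G : Subgroup (Perm Ω)) (d : ℕ → ℕ) : Prop :=
  ∃ (a : Blocks d ↪ Ω) (s : Perm Ω), ∀ f : ∀ k, Perm (Fin (d k)),
    ∃ g ∈ G, ∀ k i, (g⁻¹ * s * g) (a ⟨k, i⟩) = a ⟨k, f k i⟩

theorem viaEmbedding_apply_eq {X : Type*} (ψ : Perm X) (e : X ↪ Ω) (x : X) :
    ψ.viaEmbedding e (e x) = e (ψ x) := Perm.viaEmbedding_apply ψ e x

/-- Commuting with a shift isolates the block permutations on one of infinitely many copies. -/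
theorem Realizes.blockCopy_le {G : Subgroup (Perm Ω)} {d : ℕ → ℕ} (ε : ℕ ≃ ℕ × ℤ)
    (hne : Nonempty (Blocks d)) (h : Realizes G fun k => d (ε k).1) :
    ∃ e : Blocks d ↪ Ω, (range e)ᶜ.Infinite ∧ Le (blockCopy e) G := by
  classical
  obtain ⟨a, s, has⟩ := h
  let τ₀ : Blocks (fun k => d (ε k).1) → Blocks d × ℤ := fun y => (⟨(ε y.1).1, y.2⟩, (ε y.1).2)
  have hτ : Function.Bijective τ₀ := by
    constructor
    · rintro ⟨k, i⟩ ⟨k', i'⟩ hk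
      simp only [τ₀, Prod.mk.injEq, Sigma.mk.injEq] at hk
      obtain rfl : k = k' := ε.injective (Prod.ext hk.1.1 hk.2)
      simpa using hk.1.2
    · rintro ⟨⟨m, i⟩, n⟩
      obtain ⟨k, hk⟩ := ε.surjective (m, n)
      obtain rfl : (ε k).1 = m := by rw [hk]
      obtain rfl : (ε k).2 = n := by rw [hk]
      exact ⟨⟨k, i⟩, rfl⟩
  let τ := Equiv.ofBijective τ₀ hτ
  let a' : Blocks d × ℤ ↪ Ω := τ.symm.toEmbedding.trans a
  let S : Perm (Blocks d × ℤ) :=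
    { toFun := fun p => (p.1, p.2 + 1)
      invFun := fun p => (p.1, p.2 - 1)
      left_inv := fun p => by simp
      right_inv := fun p => by simp }
  let u : Perm Ω := S.viaEmbedding a'
  let e : Blocks d ↪ Ω := ⟨fun x => a' (x, 0), fun x y h => by simpa using h⟩
  refine ⟨e, ?_, {s, u}, by simp, ?_⟩
  · obtain ⟨x⟩ := hne
    refine Set.infinite_of_injective_forall_mem (f := fun n : ℕ => a' (x, (n : ℤ) + 1))
      (fun m n h => by simpa using h) ?_
    rintro n ⟨y, hy⟩
    have := a'.injective hy
    simp only [Prod.mk.injEq] at this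
    omega
  rintro _ ⟨ψ, hψ, rfl⟩
  rw [Perm.viaEmbeddingHom_apply]
  set H := Subgroup.closure ((G : Set (Perm Ω)) ∪ {s, u})
  obtain ⟨f, hf⟩ := exists_family_of_mem_blockGroup hψ
  -- The same permutation is requested on all copies with nonnegative index and the identity on the
  -- others.
  obtain ⟨g, hg, hgs⟩ := has fun k => if 0 ≤ (ε k).2 then f (ε k).1 else 1
  have hgH : g ∈ H := le_closure_union_left _ _ hg
  have hsH : s ∈ H := Subgroup.subset_closure (by simp)
  have huH : u ∈ H := Subgroup.subset_closure (by simp)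
  set w := g⁻¹ * s * g with hw
  have hwH : w ∈ H := H.mul_mem (H.mul_mem (H.inv_mem hgH) hsH) hgH
  have hwa : ∀ x n, w (a' (x, n)) = a' (if 0 ≤ n then ψ x else x, n) := by
    intro x n
    obtain ⟨⟨k, i⟩, hki⟩ := τ.surjective (x, n)
    have hx : x = ⟨(ε k).1, i⟩ := (congrArg Prod.fst hki).symm
    have hn : n = (ε k).2 := (congrArg Prod.snd hki).symm
    have h1 : a' (x, n) = a ⟨k, i⟩ := by
      rw [← hki]; simp [a']
    have h2 : ∀ j, a ⟨k, j⟩ = a' (⟨(ε k).1, j⟩, (ε k).2) := by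
      intro j
      have : τ ⟨k, j⟩ = (⟨(ε k).1, j⟩, (ε k).2) := rfl
      rw [← this]; simp [a']
    rw [h1, hgs, h2, hn, hx, hf]
    split_ifs <;> rfl
  have hwa' : ∀ x n, w⁻¹ (a' (x, n)) = a' (if 0 ≤ n then ψ⁻¹ x else x, n) := by
    intro x n
    rw [Perm.inv_eq_iff_eq, hwa]
    split_ifs <;> simp
  have hu : ∀ x n, u (a' (x, n)) = a' (x, n + 1) := fun x n => viaEmbedding_apply_eq S a' (x, n)
  have hu' : ∀ x n, u⁻¹ (a' (x, n)) = a' (x, n - 1) := fun x n => by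
    rw [Perm.inv_eq_iff_eq, hu]; simp
  have hu0 : ∀ y ∉ range a', u y = y := fun y hy => Perm.viaEmbedding_apply_of_notMem S a' y hy
  -- The action of `w` off `range a'` is unknown, but `w` preserves that range and `u` is trivial
  -- outside it, so the commutator is trivial there. Inside, everything cancels except on copy `0`.
  have hc : w * u * w⁻¹ * u⁻¹ ∈ H :=
    H.mul_mem (H.mul_mem (H.mul_mem hwH huH) (H.inv_mem hwH)) (H.inv_mem huH)
  convert hc
  ext y
  simp only [Perm.mul_apply]
  by_cases hy : y ∈ range a'
  · obtain ⟨⟨x, n⟩, rfl⟩ := hy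
    rw [hu', hwa', hu, hwa]
    by_cases hn : n = 0
    · subst hn
      have : ψ.viaEmbedding e (a' (x, 0)) = a' (ψ x, 0) := viaEmbedding_apply_eq ψ e x
      rw [this]
      simp
    · have : a' (x, n) ∉ range e := by
        rintro ⟨x', hx'⟩
        have := a'.injective hx'
        simp only [Prod.mk.injEq] at this
        exact hn this.2.symm
      rw [Perm.viaEmbedding_apply_of_notMem _ _ _ this]
      by_cases h0 : 0 ≤ n
      · have h1 : 1 ≤ n := by omega
        simp [h0, h1]
      · have h1 : ¬ 1 ≤ n := by omega
        simp [h0, h1]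
  · have h1 : y ∉ range e := fun ⟨x, hx⟩ => hy ⟨(x, 0), hx⟩
    have h2 : w⁻¹ y ∉ range a' := by
      rintro ⟨⟨x, n⟩, hx⟩
      exact hy ⟨_, by rw [← hwa, hx, ← Perm.mul_apply, mul_inv_cancel, Perm.one_apply]⟩
    have h3 : u⁻¹ y = y := by rw [Perm.inv_eq_iff_eq, hu0 y hy]
    rw [Perm.viaEmbedding_apply_of_notMem _ _ _ h1, h3, hu0 _ h2]
    simp

end Blocks

/-! ### Realizing blocks of arbitrary size from unbounded orbits -/

section Unbounded

variable {Ω : Type*}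

/-- Every stabilizer of a finite set has arbitrarily large orbits. -/
def HasUnboundedOrbits (G : Subgroup (Perm Ω)) : Prop :=
  ∀ T : Set Ω, T.Finite → ∀ n : ℕ, ∃ α : Ω,
    (n : ℕ∞) < (MulAction.orbit (pointwiseStabilizer G T) α).encard

/-- A closed group with unbounded orbits realizes block permutations for all block sizes. -/
theorem HasUnboundedOrbits.realizes [Countable Ω] [Nonempty Ω] {G : Subgroup (Perm Ω)}
    (hG : IsClosedSubgroup G) (h : HasUnboundedOrbits G) (d : ℕ → ℕ) : Realizes G d := by
  classical
  let C : ℕ → ℕ := fun k => Fintype.card (Perm (Fin (d k)))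
  -- Block `k` will consist of the points with indices `w k + i`. The bound `w (k + 1)` exceeds
  -- every node coded by a parent below `w k` and a permutation of block `k`.
  obtain ⟨w, hw0, hw⟩ : ∃ w : ℕ → ℕ, w 0 = 1 ∧
      ∀ k, w (k + 1) = Nat.pair (w k) (Nat.pair (C k) (w k + d k)) + 1 :=
    ⟨fun k => Nat.rec 1 (fun k w => Nat.pair w (Nat.pair (C k) (w + d k)) + 1) k,
      rfl, fun _ => rfl⟩
  have hwd : ∀ k, w k + d k < w (k + 1) := fun k => by
    rw [hw]
    have h1 := Nat.right_le_pair (w k) (Nat.pair (C k) (w k + d k))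
    have h2 := Nat.right_le_pair (C k) (w k + d k)
    omega
  have hwmono : StrictMono w := strictMono_nat_of_lt_succ fun k => by
    have := hwd k; omega
  have hw1 : ∀ k, 0 < w k := fun k => by
    have := hwmono.monotone (Nat.zero_le k); omega
  let par : ℕ → ℕ := fun n => n.unpair.1
  obtain ⟨α, γ, hα, hγ, hpath⟩ := exists_tree hG par (fun n hn => Nat.unpair_lt hn)
    -- Orbits may be finite, so point `i` must serve boundedly many nodes, with a bound known when
    -- it is chosen. The nodes of level `k` lie below `w (k + 1)`, within this bound for the points
    -- of block `k`.
    (fun N i => N < w (i + 1)) (fun i T hT => by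
      obtain ⟨a, ha⟩ := h T hT (w (i + 1) * w (i + 1) + 1)
      refine ⟨a, fun N hN => lt_of_le_of_lt ?_ ha⟩
      exact_mod_cast Nat.succ_le_succ (Nat.mul_le_mul hN.le hN.le))
  have hadm : ∀ k i N, N < w (k + 1) → N < w (w k + i + 1) := by
    intro k i N hN
    have h1 : k ≤ w k := hwmono.le_apply
    have h2 : k + 1 ≤ w k + i + 1 := by omega
    exact hN.trans_le (hwmono.monotone h2)
  have hdisj : ∀ k k' x, w k ≤ x → x < w (k + 1) → w k' ≤ x → x < w (k' + 1) → k = k' := by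
    intro k k' x h1 h2 h3 h4
    have h5 := hwmono.lt_iff_lt.mp (h1.trans_lt h4)
    have h6 := hwmono.lt_iff_lt.mp (h3.trans_lt h2)
    omega
  let a : Blocks d ↪ Ω := ⟨fun y => α (w y.1 + y.2), by
    rintro ⟨k, i⟩ ⟨k', i'⟩ heq
    have := hα _ _ ⟨0, hw1 _⟩
      ⟨0, hw1 _⟩ heq
    dsimp only at this
    have h1 := hwd k
    have h2 := hwd k'
    have h3 := i.2
    have h4 := i'.2
    obtain rfl := hdisj k k' (w k + i) (by omega) (by omega) (by omega) (by omega)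
    have : i = i' := Fin.ext (by omega)
    rw [this]⟩
  let Y := Σ k, {N // w k + d k ≤ N ∧ N < w (k + 1) ∧ par N < w k} × Fin (d k)
  let ℓ : Y ↪ Ω := ⟨fun y => γ y.2.1 (α (w y.1 + y.2.2)), by
    rintro ⟨k, ⟨N, hN1, hN2, hN3⟩, i⟩ ⟨k', ⟨N', hN1', hN2', hN3'⟩, i'⟩ heq
    obtain ⟨h1, h2⟩ := hγ N (w k + i) N' (w k' + i') (by omega) (by omega) (hadm k i N hN2)
      (by omega) (by omega) (hadm k' i' N' hN2') heq
    subst h1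
    obtain rfl := hdisj k k' N (by omega) hN2 (by omega) hN2'
    obtain rfl : i = i' := Fin.ext (by omega)
    rfl⟩
  -- A node codes its parent, a permutation of its block, and `w k + d k`; the last entry only makes
  -- the node larger than the indices of its block. `S` applies the coded permutation to the fresh
  -- images at that node.
  let π : ∀ k, ℕ → Perm (Fin (d k)) := fun k N =>
    if hc : N.unpair.2.unpair.1 < C k then (Fintype.equivFin _).symm ⟨_, hc⟩ else 1
  let S : Perm Y := Equiv.sigmaCongrRight fun k => Equiv.prodShear (Equiv.refl _) fun N => π k N
  refine ⟨a, S.viaEmbedding ℓ, fun f => ?_⟩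
  let c : ℕ → ℕ := fun k => Fintype.equivFin _ (f k)
  have hc : ∀ k, c k < C k := fun k => (Fintype.equivFin _ (f k)).2
  obtain ⟨p, hp0, hp⟩ : ∃ p : ℕ → ℕ, p 0 = 0 ∧
      ∀ k, p (k + 1) = Nat.pair (p k) (Nat.pair (c k) (w k + d k)) :=
    ⟨fun k => Nat.rec 0 (fun k M => Nat.pair M (Nat.pair (c k) (w k + d k))) k,
      rfl, fun _ => rfl⟩
  have hpw' : ∀ k, w k + d k ≤ p (k + 1) := fun k => by
    rw [hp]
    exact (Nat.right_le_pair _ _).trans (Nat.right_le_pair _ _)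
  have hpw : ∀ k, p k < w k := by
    intro k
    induction k with
    | zero => rw [hp0, hw0]; exact Nat.zero_lt_one
    | succ k ih =>
      rw [hp, hw, Nat.lt_succ_iff]
      exact ((Nat.pair_lt_pair_left _ ih).trans
        (Nat.pair_lt_pair_right _ (Nat.pair_lt_pair_left _ (hc k)))).le
  have hpar : ∀ k, par (p (k + 1)) = p k := fun k => by simp [par, hp]
  obtain ⟨g, hg, hgp⟩ := hpath p fun k =>
    ⟨by have := hpw k; have := hpw' k; omega, hpar k⟩
  refine ⟨g, hg, fun k i => ?_⟩
  have hN : w k + d k ≤ p (k + 1) ∧ p (k + 1) < w (k + 1) ∧ par (p (k + 1)) < w k :=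
    ⟨hpw' k, hpw (k + 1), by rw [hpar]; exact hpw k⟩
  have hga : ∀ j : Fin (d k), g (a ⟨k, j⟩) = ℓ ⟨k, ⟨p (k + 1), hN⟩, j⟩ := fun j =>
    hgp (k + 1) (w k + j) (by have := hpw' k; have := j.2; omega)
  have hπ : π k (p (k + 1)) = f k := by
    have h1 : (p (k + 1)).unpair.2.unpair.1 = c k := by simp [hp]
    simp only [π, h1, hc k, dif_pos]
    exact Equiv.symm_apply_apply _ _
  rw [Perm.mul_apply, Perm.mul_apply, hga, viaEmbedding_apply_eq, Perm.inv_eq_iff_eq, hga]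
  change ℓ ⟨k, ⟨p (k + 1), hN⟩, π k (p (k + 1)) i⟩ = _
  rw [hπ]

end Unbounded

/-! ### Realizing blocks of size two from bounded orbits -/

section Bounded

variable {Ω : Type*}

/-- A closed group whose stabilizers of large finite sets `T` share orbits of size at least two
with the stabilizer of a fixed finite set realizes block permutations for blocks of size two. -/
theorem realizes_two [Countable Ω] [Nonempty Ω] {G : Subgroup (Perm Ω)}
    (hG : IsClosedSubgroup G) {T₀ : Set Ω} (hT₀ : T₀.Finite) {n : ℕ} (hn : 2 ≤ n)
    (hb : ∀ α : Ω, (MulAction.orbit (pointwiseStabilizer G T₀) α).encard ≤ n)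
    (hl : ∀ T : Set Ω, T.Finite →
      ∃ α : Ω, (n : ℕ∞) ≤ (MulAction.orbit (pointwiseStabilizer G T) α).encard) :
    Realizes G fun _ => 2 := by
  classical
  obtain ⟨e, he⟩ := exists_surjective_nat Ω
  set H := pointwiseStabilizer G T₀ with hH
  let T : (ℕ → Ω) → ℕ → Set Ω := fun F i =>
    T₀ ∪ ⋃ j ∈ Iio i, (MulAction.orbit H (F j) ∪ MulAction.orbit H (e j))
  have horbfin : ∀ x : Ω, (MulAction.orbit H x).Finite := fun x =>
    finite_of_encard_le_coe (hb x)
  have hTfin : ∀ F i, (T F i).Finite := fun F i =>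
    hT₀.union ((finite_Iio i).biUnion fun j _ => (horbfin _).union (horbfin _))
  have hTcongr : ∀ F F' i, (∀ j < i, F j = F' j) → T F i = T F' i := by
    intro F F' i h
    simp only [T]
    congr 1
    refine iUnion_congr fun j => iUnion_congr fun hj => ?_
    rw [h j hj]
  have hsub : ∀ F i, pointwiseStabilizer G (T F i) ≤ H := fun F i =>
    pointwiseStabilizer_anti G subset_union_left
  -- An orbit of at least `n` points under a smaller stabilizer fills the whole `H`-orbit, which has
  -- at most `n`.
  obtain ⟨α, hα⟩ := exists_seq_of_forall_extend
    (fun i (F : ℕ → Ω) => MulAction.orbit (pointwiseStabilizer G (T F i)) (F i) =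
      MulAction.orbit H (F i) ∧
      (2 : ℕ∞) ≤ (MulAction.orbit (pointwiseStabilizer G (T F i)) (F i)).encard)
    (fun i F F' h hP => by
      rw [← hTcongr F F' i (fun j hj => h j hj.le), ← h i le_rfl]
      exact hP)
    (fun i F _ => by
      obtain ⟨a, ha⟩ := hl (T F i) (hTfin F i)
      refine ⟨a, ?_⟩
      rw [Function.update_self, hTcongr _ F i (fun j hj => Function.update_of_ne hj.ne _ _)]
      exact ⟨((horbfin a).subset (orbit_mono (hsub F i) a)).eq_of_subset_of_encard_le
        (orbit_mono (hsub F i) a) ((hb a).trans ha),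
        le_trans (by exact_mod_cast hn) ha⟩)
  have hinv : ∀ i, ∀ g ∈ H, ∀ x ∈ T α i, g x ∈ T α i := by
    intro i g hg x hx
    rcases hx with hx | hx
    · rw [hg.2 x hx]; exact Or.inl hx
    · refine Or.inr ?_
      simp only [mem_iUnion] at hx ⊢
      obtain ⟨j, hj, hx⟩ := hx
      refine ⟨j, hj, hx.imp (fun h => ?_) (fun h => ?_)⟩ <;>
      · obtain ⟨k, hk, rfl⟩ := mem_orbit_iff'.mp h
        exact mem_orbit_iff'.mpr ⟨g * k, H.mul_mem hg hk, rfl⟩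
  have hTmono : ∀ {i i'}, i ≤ i' → T α i ⊆ T α i' := fun hi =>
    union_subset_union_right _ (biUnion_mono (Iio_subset_Iio hi) fun _ _ => Subset.rfl)
  have hnot : ∀ i, α i ∉ T α i := by
    intro i hi
    have := (hα i).2
    rw [encard_orbit_of_mem hi] at this
    exact absurd this (by decide)
  have hmemT : ∀ {i j x}, j < i → x ∈ MulAction.orbit H (α j) → x ∈ T α i := fun hj hx =>
    Or.inr (mem_biUnion (mem_Iio.mpr hj) (Or.inl hx))
  have hlt : ∀ i j x, j < i → x ∈ MulAction.orbit H (α i) → x ∉ MulAction.orbit H (α j) := by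
    intro i j x hj hx hx'
    obtain ⟨g, hg, rfl⟩ := mem_orbit_iff'.mp hx
    have := hinv i g⁻¹ (H.inv_mem hg) _ (hmemT hj hx')
    rw [← Perm.mul_apply, inv_mul_cancel] at this
    exact hnot i this
  have hdisj : ∀ i j x, x ∈ MulAction.orbit H (α i) → x ∈ MulAction.orbit H (α j) → i = j := by
    intro i j x hx hx'
    rcases lt_trichotomy i j with h | h | h
    · exact absurd hx (hlt j i x h hx')
    · exact h
    · exact absurd hx' (hlt i j x h hx)
  have hself : ∀ i, α i ∈ MulAction.orbit H (α i) := fun i => MulAction.mem_orbit_self _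
  have hβ : ∀ i, ∃ β ∈ MulAction.orbit H (α i), β ≠ α i := by
    intro i
    have h1 : (1 : ℕ∞) < (MulAction.orbit H (α i)).encard := by
      rw [← (hα i).1]
      exact lt_of_lt_of_le (by decide) (hα i).2
    obtain ⟨a, b, ha, hb, hab⟩ := one_lt_encard_iff.mp h1
    by_cases h : a = α i
    · exact ⟨b, hb, fun h' => hab (h.trans h'.symm)⟩
    · exact ⟨a, ha, h⟩
  choose β hβ hβα using hβ
  -- Corrections are composed on the left. The one at stage `i` fixes the `H`-invariant set `T α i`
  -- pointwise, so earlier images stay put and the products and their inverses both converge.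
  have hfree : ∀ t : ℕ → Ω, (∀ i, t i ∈ MulAction.orbit H (α i)) →
      ∃ g ∈ G, ∀ i, g (α i) = t i := by
    intro t ht
    have hstep : ∀ i (g : H), ∃ h ∈ pointwiseStabilizer G (T α i), h ((g : Perm Ω) (α i)) = t i := by
      intro i g
      have h1 : (g : Perm Ω) (α i) ∈ MulAction.orbit (pointwiseStabilizer G (T α i)) (α i) := by
        rw [(hα i).1]; exact ⟨g, rfl⟩
      have h2 : t i ∈ MulAction.orbit (pointwiseStabilizer G (T α i)) (α i) := by
        rw [(hα i).1]; exact ht i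
      rw [← MulAction.orbit_eq_iff.mpr h1] at h2
      exact mem_orbit_iff'.mp h2
    choose h hh hht using hstep
    obtain ⟨g, hg⟩ : ∃ g : ℕ → H, ∀ i, (g (i + 1) : Perm Ω) = h i (g i) * g i :=
      ⟨fun i => Nat.rec 1 (fun i g => ⟨h i g * g, H.mul_mem (hsub _ _ (hh i g)) g.2⟩) i,
        fun _ => rfl⟩
    have hstab : ∀ i, ∀ x ∈ T α i, ∀ l ≥ i, (g l : Perm Ω) x = (g i : Perm Ω) x := by
      intro i x hx l hl
      induction l, hl using Nat.le_induction with
      | base => rfl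
      | succ l hl ih =>
        rw [hg, Perm.mul_apply, (hh l (g l)).2 _ (hinv l _ (g l).2 _ (hTmono hl hx)), ih]
    have hstab' : ∀ i, ∀ x ∈ T α i, ∀ l ≥ i, (g l : Perm Ω)⁻¹ x = (g i : Perm Ω)⁻¹ x := by
      intro i x hx l hl
      induction l, hl using Nat.le_induction with
      | base => rfl
      | succ l hl ih =>
        rw [hg, mul_inv_rev, Perm.mul_apply,
          (Subgroup.inv_mem _ (hh l (g l))).2 _ (hTmono hl hx), ih]
    have hmem : ∀ x, ∃ i, x ∈ T α i := fun x => by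
      obtain ⟨i, rfl⟩ := he x
      exact ⟨i + 1, Or.inr (mem_biUnion (mem_Iio.mpr (Nat.lt_succ_self i))
        (Or.inr (MulAction.mem_orbit_self _)))⟩
    obtain ⟨f, hf, hlim⟩ := hG.exists_limit (fun i => g i) (fun i => (g i).2.1)
      (fun x => (hmem x).imp fun i hi => hstab i x hi)
      (fun x => (hmem x).imp fun i hi => hstab' i x hi)
    refine ⟨f, hf, fun i => ?_⟩
    obtain ⟨N, hN⟩ := hlim (α i)
    rw [← hN (max N (i + 1)) (le_max_left _ _),
      hstab (i + 1) _ (hmemT (Nat.lt_succ_self i) (hself i)) _ (le_max_right _ _), hg]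
    exact hht i (g i)
  obtain ⟨ε⟩ := nonempty_equiv_of_countable (α := Blocks fun _ => 2) (β := ℕ)
  let a : Blocks (fun _ => 2) ↪ Ω := ⟨fun y => α (ε y), fun y y' h => ε.injective
    (hdisj _ _ _ (hself _) (by dsimp only at h; rw [h]; exact hself _))⟩
  let b : Blocks (fun _ => 2) ↪ Ω := ⟨fun y => β (ε y), fun y y' h => ε.injective
    (hdisj _ _ _ (hβ _) (by dsimp only at h; rw [h]; exact hβ _))⟩
  have hab : ∀ y, a y ∉ range b := by
    rintro y ⟨z, hz⟩
    have h1 : β (ε z) = α (ε y) := hz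
    have h2 := hdisj (ε z) (ε y) _ (hβ (ε z)) (by rw [h1]; exact hself _)
    rw [h2] at h1
    exact hβα _ h1
  -- The pairs of `β`-points are swapped and the `α`-points fixed. Sending a pair to its `β`-copy or
  -- leaving it in place decides whether the conjugate swaps it.
  let S : Perm (Blocks fun _ => 2) := Equiv.sigmaCongrRight fun _ => Equiv.swap 0 1
  refine ⟨a, S.viaEmbedding b, fun f => ?_⟩
  obtain ⟨g, hg, hgt⟩ := hfree
    (fun i => if f (ε.symm i).1 = 1 then α i else β i) (fun i => by
      dsimp only
      split_ifs
      exacts [hself i, hβ i])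
  refine ⟨g, hg, fun k i => ?_⟩
  have hga : ∀ j, g (a ⟨k, j⟩) = if f k = 1 then a ⟨k, j⟩ else b ⟨k, j⟩ := by
    intro j
    have := hgt (ε ⟨k, j⟩)
    rw [Equiv.symm_apply_apply] at this
    exact this
  have hf : f k = 1 ∨ f k = Equiv.swap 0 1 := by
    have : ∀ q : Perm (Fin 2), q = 1 ∨ q = Equiv.swap 0 1 := by decide
    exact this (f k)
  rw [Perm.mul_apply, Perm.mul_apply, hga, Perm.inv_eq_iff_eq, hga]
  by_cases h1 : f k = 1
  · rw [if_pos h1, if_pos h1, h1, Perm.viaEmbedding_apply_of_notMem _ _ _ (hab _)]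
    rfl
  · rw [if_neg h1, if_neg h1, viaEmbedding_apply_eq, hf.resolve_left h1]
    rfl

end Bounded

/-! ### Absorbing groups with finite blocks -/

section BlockEmbedding

variable {Ω : Type*}

/-- Numbering the points of each fiber. -/
theorem exists_fiber_index {ι : Type*} (b : Ω → ι) (n : ι → ℕ)
    (h : ∀ i, {x | b x = i}.encard ≤ n i) :
    ∃ j : Ω → ℕ, (∀ x, j x < n (b x)) ∧ ∀ x y, b x = b y → j x = j y → x = y := by
  classical
  have hJ : ∀ i, Nonempty ({x // b x = i} ↪ Fin (n i)) := by
    intro i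
    have hfin : {x | b x = i}.Finite := finite_of_encard_le_coe (h i)
    have : Finite {x // b x = i} := hfin.to_subtype
    have hc : Nat.card {x // b x = i} ≤ n i := by
      have := h i
      rw [← hfin.cast_ncard_eq] at this
      exact_mod_cast this
    exact ⟨(Finite.equivFin _).toEmbedding.trans (Fin.castLEEmb hc)⟩
  let J := fun i => (hJ i).some
  refine ⟨fun x => J (b x) ⟨x, rfl⟩, fun x => (J (b x) ⟨x, rfl⟩).2, fun x y hxy hj => ?_⟩
  have key : ∀ i (hx : b x = i), ((J (b x) ⟨x, rfl⟩ : Fin _) : ℕ) = J i ⟨x, hx⟩ := by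
    rintro i rfl; rfl
  dsimp only at hj
  rw [key (b y) hxy] at hj
  exact congrArg Subtype.val ((J (b y)).injective (Fin.ext hj))

/-- Fibers inject into the blocks, but a permutation of `Ω` carrying out this injection exists only
when complements are infinite; hence the restriction to `D`. -/
theorem inf_symOn_le_blockCopy [Countable Ω] {ι : Type*} {b : Ω → ι} {D : Set Ω}
    (hD : Dᶜ.Infinite) {d : ℕ → ℕ} {e : Blocks d ↪ Ω} (he : (range e)ᶜ.Infinite)
    {φ : ι → ℕ} (hφ : Function.Injective φ) (h : ∀ i, {x | b x = i}.encard ≤ d (φ i)) :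
    Le (blockGroup b ⊓ symOn D) (blockCopy e) := by
  obtain ⟨j, hj, hinj⟩ := exists_fiber_index b (fun i => d (φ i)) h
  let θ : Ω ↪ Blocks d := ⟨fun x => ⟨φ (b x), ⟨j x, hj x⟩⟩, fun x y hxy =>
    hinj x y (hφ (congrArg Sigma.fst hxy)) (congrArg (fun z : Blocks d => (z.2 : ℕ)) hxy)⟩
  obtain ⟨σ, hσ⟩ := exists_perm_extending (fun x : D => (x : Ω)) (fun x : D => e (θ x))
    Subtype.val_injective (e.injective.comp (θ.injective.comp Subtype.val_injective))
    (by rwa [Subtype.range_coe])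
    (he.mono (compl_subset_compl.mpr (by rintro _ ⟨x, rfl⟩; exact mem_range_self _)))
  refine Le.of_conj σ ?_
  rintro f ⟨hfb, hfD⟩
  rw [mem_blockCopy]
  have hfD' : ∀ x ∈ D, f x ∈ D := fun x hx => by
    by_contra hc
    have := f.injective (hfD _ hc)
    exact hc (by rwa [this])
  refine ⟨f.viaEmbedding θ, fun z => ?_, ?_⟩
  · by_cases hz : z ∈ range θ
    · obtain ⟨x, rfl⟩ := hz
      rw [viaEmbedding_apply_eq]
      exact congrArg φ (hfb x)
    · rw [Perm.viaEmbedding_apply_of_notMem _ _ _ hz]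
  · ext y
    obtain ⟨x, rfl⟩ := σ.surjective y
    have hR : (σ * f * σ⁻¹) (σ x) = σ (f x) := by simp
    rw [hR]
    by_cases hx : x ∈ D
    · rw [hσ ⟨x, hx⟩, hσ ⟨f x, hfD' x hx⟩, viaEmbedding_apply_eq, viaEmbedding_apply_eq]
    · rw [hfD x hx]
      by_cases hy : σ x ∈ range e
      · obtain ⟨z, hz⟩ := hy
        rw [← hz, viaEmbedding_apply_eq]
        congr 1
        by_cases hz' : z ∈ range θ
        · obtain ⟨x', rfl⟩ := hz'
          rw [viaEmbedding_apply_eq]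
          have hx' : x' ∉ D := fun hx' => hx (by
            have := (hσ ⟨x', hx'⟩).trans hz
            rwa [← σ.injective this])
          rw [hfD x' hx']
        · exact Perm.viaEmbedding_apply_of_notMem _ _ _ hz'
      · exact Perm.viaEmbedding_apply_of_notMem _ _ _ hy

/-- Block groups with finite blocks embed, up to finitely many generators, into block copies
with sufficiently large blocks. -/
theorem blockGroup_le_blockCopy [Countable Ω] [Infinite Ω] {ι : Type*} {b : Ω → ι}
    {d : ℕ → ℕ} {e : Blocks d ↪ Ω} (he : (range e)ᶜ.Infinite)
    {φ : ι → ℕ} (hφ : Function.Injective φ) (h : ∀ i, {x | b x = i}.encard ≤ d (φ i)) :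
    Le (blockGroup b) (blockCopy e) := by
  classical
  have hrange : (range b).Infinite := by
    intro hfin
    refine infinite_univ (α := Ω) ((hfin.biUnion (t := fun i => {x | b x = i})
      fun i _ => finite_of_encard_le_coe (h i)).subset fun x _ => ?_)
    exact mem_biUnion (mem_range_self x) rfl
  -- Colouring fibers rather than points makes `D` and its complement unions of fibers, so each
  -- block permutation factors along them.
  obtain ⟨c, hc⟩ := exists_splitting (fun _ : Unit => range b) fun _ => hrange
  let D : Set Ω := {x | c (b x) = 0}
  have hpre : ∀ j, {x | c (b x) = j}.Infinite := fun j hfin =>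
    hc () j ((hfin.image b).subset (by rintro _ ⟨⟨x, rfl⟩, hx⟩; exact ⟨x, hx, rfl⟩))
  have hD : D.Infinite := hpre 0
  have hD' : Dᶜ.Infinite := (hpre 1).mono fun x (hx : c (b x) = 1) => by simp [D, hx]
  refine Le.trans (Le.of_le ?_) ((inf_symOn_le_blockCopy (D := D) hD' he hφ h).sup
    (inf_symOn_le_blockCopy (D := Dᶜ) (by rwa [compl_compl]) he hφ h))
  intro f hf
  have hfD : ∀ x, x ∈ D ↔ f x ∈ D := fun x => by
    simp only [D, mem_ofPred_eq, hf x]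
  let g : Perm Ω := Perm.ofSubtype (Perm.subtypePerm f (p := (· ∈ D)) fun x => (hfD x).symm)
  have h1 : ∀ x ∈ D, g x = f x := fun x hx => by
    rw [Perm.ofSubtype_apply_of_mem _ hx]; rfl
  have h2 : g ∈ symOn D := fun x hx => Perm.ofSubtype_apply_of_not_mem _ hx
  have h3 : g ∈ blockGroup b := fun x => by
    by_cases hx : x ∈ D
    · rw [h1 x hx, hf x]
    · rw [h2 x hx]
  have h4 : g⁻¹ * f ∈ symOn Dᶜ := fun x hx => by
    rw [Perm.mul_apply, Perm.inv_eq_iff_eq, h1 x (by simpa using hx)]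
  have h5 : g⁻¹ * f ∈ blockGroup b := Subgroup.mul_mem _ (Subgroup.inv_mem _ h3) hf
  have := Subgroup.mul_mem _ (Subgroup.mem_sup_left (T := blockGroup b ⊓ symOn Dᶜ)
    (show g ∈ blockGroup b ⊓ symOn D from ⟨h3, h2⟩))
    (Subgroup.mem_sup_right (S := blockGroup b ⊓ symOn D)
      (show g⁻¹ * f ∈ blockGroup b ⊓ symOn Dᶜ from ⟨h5, h4⟩))
  simpa using this

/-- A group preserving blocks of bounded size is generated by finitely many groups preserving
blocks of size at most two. -/
theorem blockGroup_le_iSup {ι : Type*} (b : Ω → ι) (n : ℕ) (j : Ω → ℕ) (hj : ∀ x, j x < n)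
    (hinj : ∀ x y, b x = b y → j x = j y → x = y) :
    blockGroup b ≤ ⨆ kl : Fin n × Fin n,
      blockGroup fun x => (b x, if j x = kl.1 then (kl.2 : ℕ) else j x) := by
  classical
  set M := ⨆ kl : Fin n × Fin n,
    blockGroup fun x => (b x, if j x = kl.1 then (kl.2 : ℕ) else j x) with hM
  have key : ∀ J ≤ n, ∀ f ∈ blockGroup b, (∀ x, J ≤ j x → f x = x) → f ∈ M := by
    intro J
    induction J with
    | zero =>
      intro _ f _ hfix
      have : f = 1 := by ext x; exact hfix x (Nat.zero_le _)
      rw [this]; exact M.one_mem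
    | succ J ihJ =>
      intro hJ
      -- The points of index `J` get fixed in all blocks at once, in rounds according to the index
      -- of their image: after the rounds below `J - m`, only images of index at least `J - m`
      -- remain.
      have key2 : ∀ m ≤ J, ∀ f ∈ blockGroup b, (∀ x, J + 1 ≤ j x → f x = x) →
          (∀ x, j x = J → f x = x ∨ J - m ≤ j (f x)) → f ∈ M := by
        intro m
        induction m with
        | zero =>
          intro _ f hf hfix hJx
          refine ihJ (by omega) f hf fun x hx => ?_
          rcases hx.lt_or_eq with hx | hx
          · exact hfix x hx
          · rcases hJx x hx.symm with h | h
            · exact h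
            · rcases h.lt_or_eq with h | h
              · exact f.injective (hfix (f x) h)
              · exact hinj _ _ (hf x) (by omega)
        | succ m ihm =>
          intro hm f hf hfix hJx
          set i := J - (m + 1) with hi
          have hiJ : i < J := by omega
          -- This exchanges `x` and `f x` wherever `f` takes index `J` to `i`. It moves only indices
          -- `J` and `i`, hence lies in one of the generating groups.
          let c₀ : Ω → Ω := fun x => if j x = J ∧ j (f x) = i then f x else
            if j x = i ∧ j (f⁻¹ x) = J then f⁻¹ x else x
          have hc₀ : Function.Involutive c₀ := by
            intro x
            by_cases h1 : j x = J ∧ j (f x) = i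
            · have h2 : ¬ (j (f x) = J ∧ j (f (f x)) = i) := by omega
              simp [c₀, h1, hiJ.ne]
            · by_cases h2 : j x = i ∧ j (f⁻¹ x) = J
              · have h2' : j (f.symm x) = J := h2.2
                simp [c₀, h2.1, h2', hiJ.ne]
              · have : c₀ x = x := by simp only [c₀, if_neg h1, if_neg h2]
                rw [this, this]
          let c : Perm Ω := hc₀.toPerm
          have hc1 : ∀ x, j x = J → j (f x) = i → c (f x) = x := by
            intro x hx hfx
            change c₀ (f x) = x
            simp [c₀, hx, hfx, hiJ.ne]
          have hc2 : ∀ x, j x ≠ J → j x ≠ i → c x = x := by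
            intro x hx hx'
            change c₀ x = x
            simp [c₀, hx, hx']
          have hc3 : ∀ x, j x = J → f x = x → c x = x := by
            intro x hx hfx
            change c₀ x = x
            simp [c₀, hx, hfx, hiJ.ne']
          have hcM : c ∈ M := by
            refine (le_iSup (fun kl : Fin n × Fin n =>
              blockGroup fun x => (b x, if j x = kl.1 then (kl.2 : ℕ) else j x))
              (⟨J, by omega⟩, ⟨i, by omega⟩)) fun x => ?_
            change (b (c₀ x), _) = _
            have hf' := (blockGroup b).inv_mem hf x
            by_cases h1 : j x = J ∧ j (f x) = i
            · have : c x = f x := if_pos h1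
              rw [show c₀ x = f x from this, this]
              simp [hf x, h1]
            · by_cases h2 : j x = i ∧ j (f⁻¹ x) = J
              · have : c x = f⁻¹ x := (if_neg h1).trans (if_pos h2)
                rw [show c₀ x = f⁻¹ x from this, this, hf']
                simp only [h2.1, h2.2, if_pos, hiJ.ne, if_false]
              · have : c x = x := (if_neg h1).trans (if_neg h2)
                rw [show c₀ x = x from this, this]
          have hcb : c ∈ blockGroup b := by
            intro x
            change b (c₀ x) = b x
            have hf' := (blockGroup b).inv_mem hf x
            simp only [c₀]
            split_ifs
            exacts [hf x, hf', rfl]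
          have : c * f ∈ M := by
            refine ihm (by omega) _ (Subgroup.mul_mem _ hcb hf) (fun x hx => ?_) fun x hx => ?_
            · rw [Perm.mul_apply, hfix x hx, hc2 x (by omega) (by omega)]
            · rw [Perm.mul_apply]
              rcases hJx x hx with h | h
              · exact Or.inl (by rw [h, hc3 x hx h])
              · by_cases h1 : j (f x) = i
                · exact Or.inl (hc1 x hx h1)
                · by_cases h2 : j (f x) = J
                  · have := hinj _ _ (hf x) (h2.trans hx.symm)
                    exact Or.inl (by rw [this, hc3 x hx this])
                  · rw [hc2 _ h2 h1]
                    exact Or.inr (by omega)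
          have := M.mul_mem (M.inv_mem hcM) this
          simpa using this
      intro f hf hfix
      exact key2 J le_rfl f hf hfix fun x _ => Or.inr (by omega)
  intro f hf
  exact key n le_rfl f hf fun x hx => absurd (hj x) (by omega)

/-- Merging two index values leaves fibers of at most two points, so each of the finitely many
generating groups embeds in blocks of size two. -/
theorem blockGroup_le_blockCopy_two [Countable Ω] [Infinite Ω] {ι : Type*} [Countable ι]
    {b : Ω → ι} {n : ℕ} (h : ∀ i, {x | b x = i}.encard ≤ n)
    {e : Blocks (fun _ => 2) ↪ Ω} (he : (range e)ᶜ.Infinite) :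
    Le (blockGroup b) (blockCopy e) := by
  obtain ⟨j, hj, hinj⟩ := exists_fiber_index b (fun _ => n) h
  refine (Le.of_le (blockGroup_le_iSup b n j hj hinj)).trans (Le.iSup fun kl => ?_)
  obtain ⟨φ, hφ⟩ := exists_injective_nat (ι × ℕ)
  refine blockGroup_le_blockCopy he hφ ?_
  rintro ⟨i, m⟩
  have hsub : {x | (b x, if j x = kl.1 then (kl.2 : ℕ) else j x) = (i, m)} ⊆
      {x | b x = i ∧ j x = m} ∪ {x | b x = i ∧ j x = kl.1} := by
    intro x hx
    simp only [mem_ofPred_eq, Prod.mk.injEq] at hx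
    by_cases hk : j x = kl.1
    · exact Or.inr ⟨hx.1, hk⟩
    · rw [if_neg hk] at hx
      exact Or.inl hx
  have hone : ∀ m, {x | b x = i ∧ j x = m}.encard ≤ 1 := fun m =>
    encard_le_one_iff.mpr fun x y hx hy =>
      hinj x y (hx.1.trans hy.1.symm) (hx.2.trans hy.2.symm)
  refine (encard_le_encard hsub).trans ((encard_union_le _ _).trans
    ((add_le_add (hone _) (hone _)).trans ?_))
  norm_num

end BlockEmbedding

/-! ### Factoring permutations of ℕ along interval partitions -/

section Factorization

/-- Two exhaustions by finite sets of the same sizes are matched by a permutation. -/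
theorem exists_perm_matching_exhaustions {X : Type*} (V W : ℕ → Set X)
    (hV : Monotone V) (hW : Monotone W) (hV0 : V 0 = ∅) (hW0 : W 0 = ∅)
    (hVu : ∀ x, ∃ j, x ∈ V j) (hWu : ∀ x, ∃ j, x ∈ W j)
    (hVf : ∀ j, (V j).Finite) (hWf : ∀ j, (W j).Finite) (h : ∀ j, (V j).ncard = (W j).ncard) :
    ∃ q : Perm X, ∀ j x, q x ∈ V j ↔ x ∈ W j := by
  classical
  have hle : ∀ {V : ℕ → Set X} (hV : Monotone V) (hVu : ∀ x, ∃ j, x ∈ V j) (x : X) (j : ℕ),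
      Nat.find (hVu x) ≤ j ↔ x ∈ V j := fun hV hVu x j =>
    ⟨fun hj => hV hj (Nat.find_spec (hVu x)), fun hj => Nat.find_min' _ hj⟩
  have hfib : ∀ {V : ℕ → Set X} (hV : Monotone V) (hVu : ∀ x, ∃ j, x ∈ V j) (j : ℕ),
      {x | Nat.find (hVu x) = j + 1} = V (j + 1) \ V j := by
    intro V hV hVu j
    ext x
    rw [mem_sdiff, ← hle hV hVu x, ← hle hV hVu x, mem_ofPred_eq]
    omega
  -- The colour of a point is the stage at which it enters the exhaustion; equal sizes give
  -- equinumerous colour classes.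
  obtain ⟨q, hq⟩ := exists_perm_comp_eq (fun x => Nat.find (hWu x)) (fun x => Nat.find (hVu x))
    (fun j => by
      rcases j with _ | j
      · have h1 : IsEmpty {x // Nat.find (hWu x) = 0} := ⟨fun x => by
          have := (hle hW hWu x.1 0).mp x.2.le
          rw [hW0] at this; exact this⟩
        have h2 : IsEmpty {x // Nat.find (hVu x) = 0} := ⟨fun x => by
          have := (hle hV hVu x.1 0).mp x.2.le
          rw [hV0] at this; exact this⟩
        exact ⟨Equiv.equivOfIsEmpty _ _⟩
      · have h1 : Finite {x // Nat.find (hWu x) = j + 1} := by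
          have : {x | Nat.find (hWu x) = j + 1}.Finite := by
            rw [hfib hW hWu]; exact (hWf _).sdiff
          exact this.to_subtype
        have h2 : Finite {x // Nat.find (hVu x) = j + 1} := by
          have : {x | Nat.find (hVu x) = j + 1}.Finite := by
            rw [hfib hV hVu]; exact (hVf _).sdiff
          exact this.to_subtype
        refine Finite.card_eq.mp ?_
        change {x | Nat.find (hWu x) = j + 1}.ncard = {x | Nat.find (hVu x) = j + 1}.ncard
        rw [hfib hW hWu, hfib hV hVu, ncard_sdiff (hW (Nat.le_succ j)) (hWf j),
          ncard_sdiff (hV (Nat.le_succ j)) (hVf j), h, h])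
  refine ⟨q, fun j x => ?_⟩
  rw [← hle hV hVu, ← hle hW hWu, hq]

/-- A permutation of `ℕ` which moves each initial segment `[0, n k)` into the next one is a product
of two permutations preserving the initial segments with odd and even index, respectively. -/
theorem exists_factorization (f : Perm ℕ) (n : ℕ → ℕ) (hn : StrictMono n) (h0 : n 0 = 0)
    (hf : ∀ k x, x < n k → f x < n (k + 1)) (hf' : ∀ k x, x < n k → f⁻¹ x < n (k + 1)) :
    ∃ p q : Perm ℕ, f = p * q ∧ (∀ k x, q x < n (2 * k) ↔ x < n (2 * k)) ∧
      (∀ k x, p x < n (2 * k + 1) ↔ x < n (2 * k + 1)) := by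
  classical
  have hcard : ∀ m, (Iio m : Set ℕ).ncard = m := fun m => by
    rw [ncard_eq_toFinset_card']; simp
  have hpre : ∀ m, {x | f x < m} = f.symm '' Iio m := fun m => by
    rw [Equiv.image_symm_eq_preimage]; rfl
  -- A `q` taking `W j` onto `[0, n j)` preserves the even initial segments and agrees with `f`
  -- about the odd ones, so `f * q⁻¹` preserves the latter. The growth hypotheses make `W`
  -- increasing.
  let W : ℕ → Set ℕ := fun j => if Even j then Iio (n j) else {x | f x < n j}
  have hW : Monotone W := monotone_nat_of_le_succ fun j x hx => by
    by_cases hj : Even j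
    · have hj' : ¬ Even (j + 1) := by simpa [Nat.even_add_one] using hj
      simp only [W, if_pos hj, if_neg hj'] at hx ⊢
      exact hf j x hx
    · have hj' : Even (j + 1) := by simpa [Nat.even_add_one] using hj
      simp only [W, if_neg hj, if_pos hj'] at hx ⊢
      have := hf' j (f x) hx
      simpa using this
  obtain ⟨q, hq⟩ := exists_perm_matching_exhaustions (fun j => Iio (n j)) W
    (fun i j hij => Iio_subset_Iio (hn.monotone hij)) hW (by simp [h0]) (by simp [W, h0])
    (fun x => ⟨x + 1, (Nat.lt_succ_self x).trans_le hn.le_apply⟩)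
    (fun x => ⟨2 * (x + 1), by
      have : x < n (2 * (x + 1)) := by
        have : 2 * (x + 1) ≤ n (2 * (x + 1)) := hn.le_apply
        omega
      simpa [W] using this⟩)
    (fun j => finite_Iio _)
    (fun j => by
      simp only [W]
      split_ifs
      · exact finite_Iio _
      · rw [hpre]; exact (finite_Iio _).image _)
    (fun j => by
      simp only [W]
      split_ifs
      · rfl
      · rw [hpre, ncard_image_of_injective _ f.symm.injective])
  refine ⟨f * q⁻¹, q, by simp, fun k x => ?_, fun k x => ?_⟩
  · have := hq (2 * k) x
    simpa [W] using this
  · have := hq (2 * k + 1) (q⁻¹ x)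
    simpa [W, Nat.even_add_one] using this.symm

/-- Fast growing sequences adapted to a permutation of `ℕ`, each term being coded by the term two
places earlier. -/
theorem exists_coded_seq (f : Perm ℕ) : ∃ n : ℕ → ℕ, StrictMono n ∧ n 0 = 0 ∧
    (n 1).unpair.1 = 0 ∧ (∀ k, (n (k + 2)).unpair.1 = n k) ∧
    (∀ k x, x < n k → f x < n (k + 1)) ∧ (∀ k x, x < n k → f⁻¹ x < n (k + 1)) := by
  let B : ℕ → ℕ := fun m => m + 1 + ∑ x ∈ Finset.range m, (f x + f⁻¹ x)
  have hB : ∀ m x, x < m → f x < B m ∧ f⁻¹ x < B m := by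
    intro m x hx
    have := Finset.single_le_sum (f := fun x => f x + f⁻¹ x) (fun _ _ => Nat.zero_le _)
      (Finset.mem_range.mpr hx)
    simp only [B]
    omega
  -- The state holds two consecutive terms. Coding two places back makes the even-indexed terms a
  -- branch of the tree, and the odd-indexed ones another after prefixing the root `0`.
  let s : ℕ → ℕ × ℕ := fun k =>
    Nat.rec (0, Nat.pair 0 (B 0)) (fun _ p => (p.2, Nat.pair p.1 (B p.2))) k
  have hs : ∀ k, s (k + 1) = ((s k).2, Nat.pair (s k).1 (B (s k).2)) := fun _ => rfl
  let n : ℕ → ℕ := fun k => (s k).1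
  have hn1 : ∀ k, n (k + 1) = (s k).2 := fun k => by simp only [n, hs]
  have hn2 : ∀ k, n (k + 2) = Nat.pair (n k) (B (n (k + 1))) := fun k => by
    rw [hn1 (k + 1), hs, hn1]
  have hgrow : ∀ k, B (n k) ≤ n (k + 1) := by
    rintro (_ | k)
    · change B 0 ≤ Nat.pair 0 (B 0)
      exact Nat.right_le_pair _ _
    · rw [hn2]; exact Nat.right_le_pair _ _
  refine ⟨n, strictMono_nat_of_lt_succ fun k => ?_, rfl, ?_, fun k => ?_, fun k x hx => ?_,
    fun k x hx => ?_⟩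
  · have := hgrow k
    have : n k + 1 ≤ B (n k) := Nat.le_add_right _ _
    omega
  · change (Nat.pair 0 (B 0)).unpair.1 = 0; simp
  · rw [hn2]; simp
  · exact (hB _ x hx).1.trans_le (hgrow k)
  · exact (hB _ x hx).2.trans_le (hgrow k)

end Factorization

/-! ### Generating the symmetric group from infinite orbits -/

section InfiniteOrbits

variable {Ω : Type*}

theorem exists_viaEmbedding_eq {X : Type*} (e : X ↪ Ω) {σ : Perm Ω} (hσ : σ ∈ symOn (range e)) :
    ∃ f : Perm X, f.viaEmbedding e = σ := by
  have h : ∀ x, σ x ∈ range e ↔ x ∈ range e := by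
    intro x
    constructor
    · intro hx
      by_contra hc
      rw [hσ x hc] at hx
      exact hc hx
    · intro hx
      by_contra hc
      have := σ.injective (hσ _ hc)
      rw [this] at hc
      exact hc hx
  let E := Equiv.ofInjective e e.injective
  refine ⟨(E.trans (σ.subtypePerm h)).trans E.symm, ?_⟩
  ext y
  by_cases hy : y ∈ range e
  · obtain ⟨x, rfl⟩ := hy
    rw [viaEmbedding_apply_eq]
    exact Equiv.apply_ofInjective_symm e.injective _
  · rw [Perm.viaEmbedding_apply_of_notMem _ _ _ hy, hσ y hy]

/-- Block `m` has size `m`, so pairing a number for the fiber with its size picks distinct blocks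
that are large enough. -/
theorem blockGroup_le_blockCopy_id [Countable Ω] [Infinite Ω] {ι : Type*} [Countable ι]
    {b : Ω → ι} (h : ∀ i, {x | b x = i}.Finite)
    {e : Blocks (fun k => k) ↪ Ω} (he : (range e)ᶜ.Infinite) :
    Le (blockGroup b) (blockCopy e) := by
  obtain ⟨c, hc⟩ := exists_injective_nat ι
  refine blockGroup_le_blockCopy he (φ := fun i => Nat.pair (c i) {x | b x = i}.ncard)
    (fun i j hij => ?_) fun i => ?_
  · simp only [Nat.pair_eq_pair] at hij
    exact hc hij.1
  · rw [← (h i).cast_ncard_eq]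
    exact_mod_cast Nat.right_le_pair _ _

/-- The symmetric group is finitely generated over every closed group all of whose stabilizers of
finite sets have infinite orbits. -/
theorem HasInfiniteOrbits.top_le [Countable Ω] [Infinite Ω] {G : Subgroup (Perm Ω)}
    (hG : IsClosedSubgroup G) (h : HasInfiniteOrbits G) : Le ⊤ G := by
  classical
  obtain ⟨ε⟩ := nonempty_equiv_of_countable (α := ℕ) (β := ℕ × ℤ)
  obtain ⟨e, he, hle⟩ := Realizes.blockCopy_le (d := fun k => k) ε ⟨⟨1, 0⟩⟩
    (HasUnboundedOrbits.realizes hG (fun T hT n => by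
      obtain ⟨a, ha⟩ := h T hT
      exact ⟨a, by rw [ha.encard_eq]; exact ENat.natCast_lt_top n⟩) _)
  let par : ℕ → ℕ := fun n => n.unpair.1
  obtain ⟨α, γ, hα, hγ, hpath⟩ := exists_tree hG par (fun n hn => Nat.unpair_lt hn)
    (fun _ _ => True) (fun i T hT => by
      obtain ⟨a, ha⟩ := h T hT
      exact ⟨a, fun N _ => by rw [ha.encard_eq]; exact ENat.natCast_lt_top _⟩)
  let A : ℕ ↪ Ω := ⟨α, fun i i' => hα i i' ⟨0, trivial⟩ ⟨0, trivial⟩⟩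
  -- Each node has a finite block of fresh images; all remaining points are singletons. This single
  -- partition serves all branches.
  let b : Ω → ℕ ⊕ Ω := fun y =>
    if hy : ∃ N i, par N ≤ i ∧ i < N ∧ γ N (α i) = y then Sum.inl hy.choose else Sum.inr y
  have hb : ∀ N i, par N ≤ i → i < N → b (γ N (α i)) = Sum.inl N := by
    intro N i hi hi'
    have hy : ∃ N' i', par N' ≤ i' ∧ i' < N' ∧ γ N' (α i') = γ N (α i) := ⟨N, i, hi, hi', rfl⟩
    have hby : b (γ N (α i)) = Sum.inl hy.choose := dif_pos hy
    obtain ⟨i', h1, h2, h3⟩ := hy.choose_spec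
    rw [hby, (hγ _ _ _ _ h1 h2 trivial hi hi' trivial h3).1]
  have hbfin : ∀ z, {y | b y = z}.Finite := by
    rintro (N | z)
    · refine ((finite_Iio N).image fun i => γ N (α i)).subset fun y hy => ?_
      simp only [b, mem_ofPred_eq] at hy
      split_ifs at hy with hc
      obtain ⟨i, _, h2, h3⟩ := hc.choose_spec
      have : hc.choose = N := Sum.inl.inj hy
      rw [this] at h2 h3
      exact ⟨i, h2, h3⟩
    · refine (finite_singleton z).subset fun y hy => ?_
      simp only [b, mem_ofPred_eq] at hy
      split_ifs at hy with hc
      exact Sum.inr.inj hy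
  obtain ⟨U, hU, hUG⟩ := (blockGroup_le_blockCopy_id hbfin he).trans hle
  set H := Subgroup.closure ((G : Set (Perm Ω)) ∪ U)
  have hGH : G ≤ H := le_closure_union_left _ _
  have hkey : ∀ p : ℕ → ℕ, p 0 = 0 → (∀ k, p k < p (k + 1) ∧ par (p (k + 1)) = p k) →
      ∀ ψ : Perm ℕ, (∀ k i, ψ i < p k ↔ i < p k) → ψ.viaEmbedding A ∈ H := by
    intro p hp0 hp ψ hψ
    obtain ⟨g, hg, hgα⟩ := hpath p hp
    have hmono : StrictMono p := strictMono_nat_of_lt_succ fun k => (hp k).1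
    -- `g` takes the points with indices in `[p k, p (k + 1))` into the block of node `p (k + 1)`,
    -- and `ψ` preserves these intervals.
    have hmem : g * ψ.viaEmbedding A * g⁻¹ ∈ blockGroup b := by
      intro y
      obtain ⟨x, rfl⟩ := g.surjective y
      have h1 : (g * ψ.viaEmbedding A * g⁻¹) (g x) = g (ψ.viaEmbedding A x) := by simp
      rw [h1]
      by_cases hx : x ∈ range A
      · obtain ⟨i, rfl⟩ := hx
        rw [viaEmbedding_apply_eq]
        have hex : ∃ k, i < p k := ⟨i + 1, (Nat.lt_succ_self i).trans_le hmono.le_apply⟩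
        obtain ⟨k, hk⟩ : ∃ k, Nat.find hex = k + 1 := by
          refine Nat.exists_eq_succ_of_ne_zero fun h0 => ?_
          have := Nat.find_spec hex
          rw [h0, hp0] at this
          omega
        have hik : i < p (k + 1) := hk ▸ Nat.find_spec hex
        have hik' : ¬ i < p k := Nat.find_min hex (by omega)
        have hb' : ∀ j, j < p (k + 1) → ¬ j < p k → b (g (A j)) = Sum.inl (p (k + 1)) :=
          fun j hj hj' => by
            change b (g (α j)) = _
            rw [hgα (k + 1) j hj]
            exact hb _ _ (by rw [(hp k).2]; omega) hj
        rw [hb' i hik hik', hb' (ψ i) ((hψ _ _).mpr hik) fun hc => hik' ((hψ _ _).mp hc)]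
      · rw [Perm.viaEmbedding_apply_of_notMem _ _ _ hx]
    have := H.mul_mem (H.mul_mem (H.inv_mem (hGH hg)) (hUG hmem)) (hGH hg)
    simpa [mul_assoc] using this
  have hall : ∀ f : Perm ℕ, f.viaEmbedding A ∈ H := by
    intro f
    obtain ⟨n, hn, hn0, hn1, hn2, hf, hf'⟩ := exists_coded_seq f
    obtain ⟨p, q, hpq, hq, hp⟩ := exists_factorization f n hn hn0 hf hf'
    have h1 : q.viaEmbedding A ∈ H := hkey (fun k => n (2 * k)) hn0
      (fun k => ⟨hn (by omega), hn2 (2 * k)⟩) q hq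
    have h2 : p.viaEmbedding A ∈ H := by
      refine hkey (fun k => if k = 0 then 0 else n (2 * (k - 1) + 1)) rfl (fun k => ?_) p
        fun k i => ?_
      · rcases k with _ | k
        · refine ⟨?_, hn1⟩
          have := hn (Nat.zero_lt_one)
          rw [hn0] at this
          simpa using this
        · have := hn2 (2 * k + 1)
          refine ⟨?_, ?_⟩
          · have := hn (show 2 * k + 1 < 2 * (k + 1) + 1 by omega)
            simpa using this
          · simpa [par, mul_add] using this
      · rcases k with _ | k
        · simp
        · have := hp k i
          simpa using this
    have := H.mul_mem h2 h1
    rwa [← Perm.viaEmbeddingHom_apply, ← Perm.viaEmbeddingHom_apply, ← map_mul, ← hpq] at this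
  -- The range of `A` might be cofinite; half of it surely has infinite complement.
  let R : Set Ω := range fun i => A (2 * i)
  have hR : R.Infinite := infinite_range_of_injective fun i j hij => by
    have := A.injective hij; omega
  have hR' : Rᶜ.Infinite := by
    refine Set.infinite_of_injective_forall_mem (f := fun i : ℕ => A (2 * i + 1))
      (fun i j hij => by have := A.injective hij; omega) ?_
    rintro i ⟨j, hj⟩
    have := A.injective hj
    omega
  refine (le_symOn hR hR').trans ⟨U, hU, fun σ hσ => ?_⟩
  obtain ⟨f, rfl⟩ := exists_viaEmbedding_eq A (σ := σ) fun x hx => hσ x fun ⟨i, hi⟩ =>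
    hx ⟨2 * i, hi⟩
  exact hall f

end InfiniteOrbits

/-! ### Separating the classes by growth and cardinality -/

section Balls

variable {Ω : Type*}

/-- The points reachable from `x` by one element of `K` or of `U ∪ U⁻¹`. -/
def neighbors (K : Subgroup (Perm Ω)) (U : Set (Perm Ω)) (x : Ω) : Set Ω :=
  MulAction.orbit K x ∪ ((fun u : Perm Ω => u x) '' U ∪ (fun u : Perm Ω => u⁻¹ x) '' U)

/-- The points reachable from `x` in `r` steps. -/
def reach (K : Subgroup (Perm Ω)) (U : Set (Perm Ω)) : ℕ → Ω → Set Ω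
  | 0, x => {x}
  | r + 1, x => ⋃ y ∈ reach K U r x, neighbors K U y

/-- The radius is the length of a word for `f`, hence uniform in the point. -/
theorem exists_forall_mem_reach {K : Subgroup (Perm Ω)} {U : Set (Perm Ω)} {f : Perm Ω}
    (hf : f ∈ Subgroup.closure ((K : Set (Perm Ω)) ∪ U)) : ∃ r, ∀ x, f x ∈ reach K U r x := by
  induction hf using Subgroup.closure_induction_left with
  | one => exact ⟨0, fun x => rfl⟩
  | mul_left g hg f _ ih =>
    obtain ⟨r, hr⟩ := ih
    refine ⟨r + 1, fun x => mem_biUnion (hr x) ?_⟩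
    rcases hg with hg | hg
    · exact Or.inl ⟨⟨g, hg⟩, rfl⟩
    · exact Or.inr (Or.inl ⟨g, hg, rfl⟩)
  | inv_mul_cancel g hg f _ ih =>
    obtain ⟨r, hr⟩ := ih
    refine ⟨r + 1, fun x => mem_biUnion (hr x) ?_⟩
    rcases hg with hg | hg
    · exact Or.inl ⟨⟨g⁻¹, K.inv_mem hg⟩, rfl⟩
    · exact Or.inr (Or.inr ⟨g, hg, rfl⟩)

theorem reach_finite {K : Subgroup (Perm Ω)} {U : Set (Perm Ω)} (hU : U.Finite)
    (hK : ∀ x : Ω, (MulAction.orbit K x).Finite) (r : ℕ) (x : Ω) : (reach K U r x).Finite := by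
  induction r with
  | zero => exact finite_singleton x
  | succ r ih => exact ih.biUnion fun y _ => (hK y).union ((hU.image _).union (hU.image _))

theorem exists_encard_reach_le {K : Subgroup (Perm Ω)} {U : Set (Perm Ω)} (hU : U.Finite) {n : ℕ}
    (hK : ∀ x : Ω, (MulAction.orbit K x).encard ≤ n) (r : ℕ) :
    ∃ N : ℕ, ∀ x, (reach K U r x).encard ≤ N := by
  have hnb : ∀ x, (neighbors K U x).encard ≤ ((n + (U.ncard + U.ncard) : ℕ) : ℕ∞) := by
    intro x
    have him : ∀ f : Perm Ω → Ω, (f '' U).encard ≤ (U.ncard : ℕ∞) := fun f =>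
      (encard_image_le f U).trans hU.cast_ncard_eq.ge
    push_cast
    exact (encard_union_le _ _).trans (add_le_add (hK x) ((encard_union_le _ _).trans
      (add_le_add (him _) (him _))))
  induction r with
  | zero => exact ⟨1, fun x => by simp [reach]⟩
  | succ r ih =>
    obtain ⟨N, hN⟩ := ih
    refine ⟨N * (n + (U.ncard + U.ncard)), fun x => ?_⟩
    have hfin : (reach K U r x).Finite := finite_of_encard_le_coe (hN x)
    have h1 : reach K U (r + 1) x = ⋃ y ∈ hfin.toFinset, neighbors K U y := by
      simp [reach]
    have h2 : (hfin.toFinset.card : ℕ∞) ≤ N := by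
      rw [← encard_coe_eq_coe_finsetCard, Finite.coe_toFinset]; exact hN x
    rw [h1]
    refine (Finset.set_encard_biUnion_le _ _).trans
      ((Finset.sum_le_card_nsmul _ _ _ fun y _ => hnb y).trans ?_)
    rw [nsmul_eq_mul, Nat.cast_mul]
    gcongr

/-- The symmetric group is not finitely generated over a group with finite orbits. -/
theorem not_top_le [Infinite Ω] {K : Subgroup (Perm Ω)}
    (hK : ∀ x : Ω, (MulAction.orbit K x).Finite) : ¬ Le ⊤ K := by
  rintro ⟨U, hU, htop⟩
  -- Each new point avoids the balls of radius up to `n` about the earlier ones. Swapping `z (2 *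
  -- k)` with `z (2 * k + 1)` then defeats every radius.
  obtain ⟨z, hz⟩ := exists_seq_of_forall_extend
    (fun n (F : ℕ → Ω) => ∀ m < n, F n ≠ F m ∧ ∀ r ≤ n, F n ∉ reach K U r (F m))
    (fun n F F' h hF m hm => by
      rw [← h n le_rfl, ← h m hm.le]; exact hF m hm)
    (fun n F _ => by
      have hfin : (⋃ m ∈ Iio n, ({F m} ∪ ⋃ r ∈ Iic n, reach K U r (F m))).Finite :=
        (finite_Iio n).biUnion fun m _ => (finite_singleton _).union
          ((finite_Iic n).biUnion fun r _ => reach_finite hU hK r _)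
      obtain ⟨a, ha⟩ := hfin.exists_notMem
      refine ⟨a, fun m hm => ?_⟩
      rw [Function.update_self, Function.update_of_ne hm.ne]
      refine ⟨fun h => ha (mem_biUnion (mem_Iio.mpr hm) (Or.inl h)), fun r hr h => ha
        (mem_biUnion (mem_Iio.mpr hm) (Or.inr (mem_biUnion (mem_Iic.mpr hr) h)))⟩)
  have hinj : Function.Injective z := by
    intro m n hmn
    rcases lt_trichotomy m n with h | h | h
    · exact absurd hmn.symm ((hz n) m h).1
    · exact h
    · exact absurd hmn ((hz m) n h).1
  let e : ℕ × Bool ↪ Ω := ⟨fun p => z (2 * p.1 + p.2.toNat), by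
    rintro ⟨k, b⟩ ⟨k', b'⟩ h
    have := hinj h
    rcases b with _ | _ <;> rcases b' with _ | _ <;> simp at this ⊢ <;> omega⟩
  let S : Perm (ℕ × Bool) := Equiv.prodCongr (Equiv.refl ℕ) Equiv.boolNot
  obtain ⟨r, hr⟩ := exists_forall_mem_reach (htop (Subgroup.mem_top (S.viaEmbedding e)))
  have h1 := hr (e (r, false))
  rw [viaEmbedding_apply_eq] at h1
  exact (hz (2 * r + 1) (2 * r) (Nat.lt_succ_self _)).2 r (by omega) h1

/-- Block permutations of unbounded block sizes are not finitely generated over a group with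
bounded orbits. -/
theorem not_blockCopy_id_le {K : Subgroup (Perm Ω)} {n : ℕ}
    (hK : ∀ x : Ω, (MulAction.orbit K x).encard ≤ n) (e : Blocks (fun k => k) ↪ Ω) :
    ¬ Le (blockCopy e) K := by
  rintro ⟨U, hU, hle⟩
  choose N hN using exists_encard_reach_le hU hK
  -- Block `m` is charged with defeating the radius `m.unpair.1`: if larger than every ball of that
  -- radius, it contains a point outside the ball about its first point.
  have hψ : ∀ m, ∃ ψ : Perm (Fin m), N m.unpair.1 < m →
      ∃ j, e ⟨m, ψ j⟩ ∉ reach K U m.unpair.1 (e ⟨m, j⟩) := by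
    intro m
    by_cases hm : N m.unpair.1 < m
    · let j : Fin m := ⟨0, by omega⟩
      have hinj : Function.Injective fun i : Fin m => e ⟨m, i⟩ := fun i i' h => by
        simpa using e.injective h
      have hc : (range fun i : Fin m => e ⟨m, i⟩).encard = m := by
        rw [← image_univ, hinj.encard_image]; simp
      obtain ⟨_, ⟨i, rfl⟩, hi⟩ := exists_mem_notMem_of_encard_lt
        (A := range fun i : Fin m => e ⟨m, i⟩) (B := reach K U m.unpair.1 (e ⟨m, j⟩))
        ((hN _ _).trans_lt (by rw [hc]; exact_mod_cast hm))
      exact ⟨Equiv.swap j i, fun _ => ⟨j, by rw [Equiv.swap_apply_left]; exact hi⟩⟩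
    · exact ⟨1, fun h => absurd h hm⟩
  choose ψ hψ using hψ
  let S : Perm (Blocks fun k => k) := Equiv.sigmaCongrRight ψ
  obtain ⟨r, hr⟩ := exists_forall_mem_reach (hle (mem_blockCopy.mpr ⟨S, fun _ => rfl, rfl⟩))
  obtain ⟨j, hj⟩ := hψ (Nat.pair r (N r + 1)) (by
    have := Nat.right_le_pair r (N r + 1)
    rw [Nat.unpair_pair]
    dsimp only
    omega)
  have h1 := hr (e ⟨_, j⟩)
  rw [viaEmbedding_apply_eq] at h1
  rw [Nat.unpair_pair] at hj
  exact hj h1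

/-- A finitely generated group does not contain the permutations preserving infinitely many
blocks of size two. -/
theorem not_blockCopy_two_le_bot (e : Blocks (fun _ => 2) ↪ Ω) :
    ¬ Le (blockCopy e) (⊥ : Subgroup (Perm Ω)) := by
  rintro ⟨U, hU, hle⟩
  have hc : (((⊥ : Subgroup (Perm Ω)) : Set (Perm Ω)) ∪ U).Countable := by
    refine Countable.union ?_ hU.countable
    rw [Subgroup.coe_bot]
    exact countable_singleton 1
  set H := Subgroup.closure (((⊥ : Subgroup (Perm Ω)) : Set (Perm Ω)) ∪ U) with hH
  have hcount : Countable H := by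
    have := hc.to_subtype
    rw [hH, FreeGroup.closure_eq_range]
    exact (MonoidHom.rangeRestrict_surjective _).countable
  let F : (ℕ → Perm (Fin 2)) → H := fun ψ =>
    ⟨Perm.viaEmbedding (Equiv.sigmaCongrRight ψ : Perm (Blocks fun _ => 2)) e,
      hle (mem_blockCopy.mpr ⟨_, fun _ => rfl, rfl⟩)⟩
  have hF : Function.Injective F := by
    intro ψ ψ' h
    have h1 := Perm.viaEmbeddingHom_injective e (congrArg Subtype.val h)
    funext k
    ext i
    have h2 := congrArg (fun s : Perm (Blocks fun _ => 2) => s ⟨k, i⟩) h1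
    simpa using congrArg Fin.val (eq_of_heq (Sigma.mk.inj h2).2)
  have : Countable (ℕ → Perm (Fin 2)) := hF.countable
  have h2 : Function.Injective fun (s : Set ℕ) => fun k =>
      (open Classical in if k ∈ s then Equiv.swap 0 1 else 1 : Perm (Fin 2)) := by
    intro s t hst
    ext k
    have := congrFun hst k
    have hne : (Equiv.swap 0 1 : Perm (Fin 2)) ≠ 1 := by decide
    by_cases h1 : k ∈ s <;> by_cases h2 : k ∈ t <;> simp_all
  have := h2.countable
  obtain ⟨F', hF'⟩ := exists_surjective_nat (Set ℕ)
  exact Function.cantor_surjective F' hF'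

end Balls

/-! ### Comparing closed groups with the representatives -/

section Classes

variable {Ω : Type*}

theorem le_blockGroup_orbits (K : Subgroup (Perm Ω)) :
    K ≤ blockGroup (Quotient.mk (MulAction.orbitRel K Ω)) := fun g hg _ =>
  Quotient.sound (s := MulAction.orbitRel K Ω) (MulAction.orbitRel_apply.mpr ⟨⟨g, hg⟩, rfl⟩)

theorem fiber_orbits (K : Subgroup (Perm Ω)) (x : Ω) : {y : Ω | Quotient.mk (MulAction.orbitRel K Ω) y = Quotient.mk (MulAction.orbitRel K Ω) x} =
      MulAction.orbit K x := by
  ext y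
  exact Quotient.eq.trans MulAction.orbitRel_apply

theorem le_blockCopy_id_of_finite_orbits [Countable Ω] [Infinite Ω] {G : Subgroup (Perm Ω)}
    {T : Set Ω} (hT : T.Finite) (h : ∀ α : Ω, (MulAction.orbit (pointwiseStabilizer G T) α).Finite)
    {e : Blocks (fun k => k) ↪ Ω} (he : (range e)ᶜ.Infinite) : Le G (blockCopy e) := by
  refine (le_pointwiseStabilizer G hT).trans ((Le.of_le (le_blockGroup_orbits _)).trans
    (blockGroup_le_blockCopy_id (fun i => ?_) he))
  induction i using Quotient.ind with
  | _ x => rw [fiber_orbits]; exact h x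

theorem le_blockCopy_two_of_bounded_orbits [Countable Ω] [Infinite Ω] {G : Subgroup (Perm Ω)}
    {T : Set Ω} (hT : T.Finite) {n : ℕ}
    (h : ∀ α : Ω, (MulAction.orbit (pointwiseStabilizer G T) α).encard ≤ n)
    {e : Blocks (fun _ => 2) ↪ Ω} (he : (range e)ᶜ.Infinite) : Le G (blockCopy e) := by
  refine (le_pointwiseStabilizer G hT).trans ((Le.of_le (le_blockGroup_orbits _)).trans
    (blockGroup_le_blockCopy_two (n := n) (fun i => ?_) he))
  induction i using Quotient.ind with
  | _ x => rw [fiber_orbits]; exact h x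

theorem HasFiniteUnboundedOrbits.hasUnboundedOrbits {G : Subgroup (Perm Ω)}
    (h : HasFiniteUnboundedOrbits G) : HasUnboundedOrbits G := fun T hT n => by
  by_contra! hc
  exact h.2 T hT ⟨n, hc⟩

theorem HasFiniteUnboundedOrbits.exists_blockCopy_le [Countable Ω] [Infinite Ω]
    {G : Subgroup (Perm Ω)} (hG : IsClosedSubgroup G) (h : HasFiniteUnboundedOrbits G) :
    ∃ e : Blocks (fun k => k) ↪ Ω, (range e)ᶜ.Infinite ∧ Le (blockCopy e) G := by
  obtain ⟨ε⟩ := nonempty_equiv_of_countable (α := ℕ) (β := ℕ × ℤ)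
  exact Realizes.blockCopy_le (d := fun k => k) ε ⟨⟨1, 0⟩⟩ (h.hasUnboundedOrbits.realizes hG _)

theorem eq_bot_of_orbits {K : Subgroup (Perm Ω)}
    (h : ∀ α : Ω, (MulAction.orbit K α).encard ≤ 1) : K = ⊥ := by
  rw [eq_bot_iff]
  intro f hf
  rw [Subgroup.mem_bot]
  ext x
  exact encard_le_one_iff.mp (h x) _ _ ⟨⟨f, hf⟩, rfl⟩ (MulAction.mem_orbit_self x)

theorem HasBoundedNontrivialOrbits.exists_blockCopy_le [Countable Ω] [Infinite Ω]
    {G : Subgroup (Perm Ω)} (hG : IsClosedSubgroup G) (h : HasBoundedNontrivialOrbits G) :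
    ∃ e : Blocks (fun _ => 2) ↪ Ω, (range e)ᶜ.Infinite ∧ Le (blockCopy e) G := by
  classical
  obtain ⟨ε⟩ := nonempty_equiv_of_countable (α := ℕ) (β := ℕ × ℤ)
  refine Realizes.blockCopy_le (d := fun _ => 2) ε ⟨⟨0, 0⟩⟩ ?_
  -- The least `n` bounding the orbits of some stabilizer is attained or exceeded by an orbit of
  -- every stabilizer. It is at least two because stabilizers are nontrivial.
  have hex : ∃ n : ℕ, ∃ T : Set Ω, T.Finite ∧
      ∀ α : Ω, (MulAction.orbit (pointwiseStabilizer G T) α).encard ≤ n := by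
    obtain ⟨⟨T, hT, n, _, hn⟩, _⟩ := h
    exact ⟨n, T, hT, hn⟩
  obtain ⟨T₀, hT₀, hb⟩ := Nat.find_spec hex
  refine realizes_two hG hT₀ (n := Nat.find hex) ?_ hb fun T hT => ?_
  · by_contra! hlt
    refine h.2 T₀ hT₀ (eq_bot_of_orbits fun α => (hb α).trans ?_)
    exact_mod_cast Nat.lt_succ_iff.mp hlt
  · by_contra! hc
    obtain ⟨m, hm⟩ : ∃ m, Nat.find hex = m + 1 := by
      refine Nat.exists_eq_succ_of_ne_zero fun h0 => ?_
      have := hc (Classical.arbitrary Ω)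
      rw [h0] at this
      simp at this
    refine Nat.find_min hex (m := m) (by omega) ⟨T, hT, fun α => ?_⟩
    have := hc α
    rw [hm, Nat.cast_succ] at this
    exact ENat.lt_natCast_add_one_iff.mp this

theorem HasTrivialStabilizer.le_bot [Countable Ω] [Infinite Ω] {G : Subgroup (Perm Ω)}
    (h : HasTrivialStabilizer G) : Le G ⊥ := by
  obtain ⟨T, hT, h⟩ := h
  exact h ▸ le_pointwiseStabilizer G hT

theorem orbit_of_eq_bot {K : Subgroup (Perm Ω)} (h : K = ⊥) (α : Ω) :
    (MulAction.orbit K α).encard ≤ 1 := by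
  subst h
  rw [encard_le_one_iff]
  rintro _ _ ⟨g, rfl⟩ ⟨g', rfl⟩
  rw [Subsingleton.elim g g']

/-- The four conditions are exhaustive. -/
theorem exists_orbitCondition (G : Subgroup (Perm Ω)) : ∃ i, orbitCondition i G := by
  by_cases h0 : HasInfiniteOrbits G
  · exact ⟨0, h0⟩
  have h0' : ∃ T : Set Ω, T.Finite ∧
      ∀ α : Ω, (MulAction.orbit (pointwiseStabilizer G T) α).Finite := by
    simp only [HasInfiniteOrbits] at h0
    push Not at h0
    simpa using h0
  by_cases h1 : ∃ T : Set Ω, T.Finite ∧ ∃ n : ℕ,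
      ∀ α : Ω, (MulAction.orbit (pointwiseStabilizer G T) α).encard ≤ n
  · by_cases h2 : HasTrivialStabilizer G
    · exact ⟨3, h2⟩
    · obtain ⟨T, hT, n, hn⟩ := h1
      refine ⟨2, ⟨T, hT, n + 1, Nat.succ_pos n, fun α => (hn α).trans ?_⟩,
        fun T hT h => h2 ⟨T, hT, h⟩⟩
      exact_mod_cast Nat.le_succ n
  · exact ⟨1, h0', fun T hT hn => h1 ⟨T, hT, hn⟩⟩

/-- Groups satisfying a stronger condition are not finitely generated over groups satisfying a
weaker one. -/
theorem not_le_of_orbitCondition_lt [Countable Ω] [Infinite Ω] {G₁ G₂ : Subgroup (Perm Ω)}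
    (h₁ : IsClosedSubgroup G₁) {i j : Fin 4} (hij : i < j)
    (hi : orbitCondition i G₁) (hj : orbitCondition j G₂) : ¬ Le G₁ G₂ := by
  intro hle
  have hbdd : 2 ≤ j → ∃ T : Set Ω, T.Finite ∧ ∃ n : ℕ,
      ∀ α : Ω, (MulAction.orbit (pointwiseStabilizer G₂ T) α).encard ≤ n := by
    intro h2
    fin_cases j
    · exact absurd h2 (by decide)
    · exact absurd h2 (by decide)
    · obtain ⟨⟨T, hT, n, _, hn⟩, _⟩ := hj
      exact ⟨T, hT, n, hn⟩
    · obtain ⟨T, hT, h⟩ := hj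
      exact ⟨T, hT, 1, fun α => by exact_mod_cast orbit_of_eq_bot h α⟩
  have hfin : 1 ≤ j → ∃ T : Set Ω, T.Finite ∧
      ∀ α : Ω, (MulAction.orbit (pointwiseStabilizer G₂ T) α).Finite := by
    intro h1
    by_cases h2 : 2 ≤ j
    · obtain ⟨T, hT, n, hn⟩ := hbdd h2
      exact ⟨T, hT, fun α => finite_of_encard_le_coe (hn α)⟩
    · obtain rfl : j = 1 := by omega
      exact hj.1
  fin_cases i
  · obtain ⟨T, hT, h⟩ := hfin (by change 0 < j at hij; omega)
    exact not_top_le h ((HasInfiniteOrbits.top_le h₁ hi).trans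
      (hle.trans (le_pointwiseStabilizer G₂ hT)))
  · obtain ⟨T, hT, n, hn⟩ := hbdd (by change 1 < j at hij; omega)
    obtain ⟨e, -, he⟩ := HasFiniteUnboundedOrbits.exists_blockCopy_le h₁ hi
    exact not_blockCopy_id_le hn e (he.trans (hle.trans (le_pointwiseStabilizer G₂ hT)))
  · obtain rfl : j = 3 := by change 2 < j at hij; omega
    obtain ⟨e, -, he⟩ := HasBoundedNontrivialOrbits.exists_blockCopy_le h₁ hi
    exact not_blockCopy_two_le_bot e (he.trans (hle.trans (HasTrivialStabilizer.le_bot hj)))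
  · change 3 < j at hij
    omega

theorem orbitCondition_unique [Countable Ω] [Infinite Ω] {G₁ G₂ : Subgroup (Perm Ω)}
    (h₁ : IsClosedSubgroup G₁) (h₂ : IsClosedSubgroup G₂) (h : SEquiv G₁ G₂) {i j : Fin 4}
    (hi : orbitCondition i G₁) (hj : orbitCondition j G₂) : i = j := by
  rw [sEquiv_iff] at h
  rcases lt_trichotomy i j with hij | hij | hij
  · exact absurd h.1 (not_le_of_orbitCondition_lt h₁ hij hi hj)
  · exact hij
  · exact absurd h.2 (not_le_of_orbitCondition_lt h₂ hij hj hi)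

theorem le_of_orbitCondition [Countable Ω] [Infinite Ω] {G₁ G₂ : Subgroup (Perm Ω)}
    (h₂ : IsClosedSubgroup G₂) {i : Fin 4}
    (hi : orbitCondition i G₁) (hj : orbitCondition i G₂) : Le G₁ G₂ := by
  fin_cases i
  · exact (Le.of_le le_top).trans (HasInfiniteOrbits.top_le h₂ hj)
  · obtain ⟨e, he, hle⟩ := HasFiniteUnboundedOrbits.exists_blockCopy_le h₂ hj
    obtain ⟨⟨T, hT, h⟩, _⟩ := hi
    exact (le_blockCopy_id_of_finite_orbits hT h he).trans hle
  · obtain ⟨e, he, hle⟩ := HasBoundedNontrivialOrbits.exists_blockCopy_le h₂ hj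
    obtain ⟨⟨T, hT, n, _, h⟩, _⟩ := hi
    exact (le_blockCopy_two_of_bounded_orbits hT h he).trans hle
  · exact (HasTrivialStabilizer.le_bot hi).trans (Le.of_le bot_le)

end Classes

/-! ### Block groups as examples for the four conditions -/

section Examples

variable {Ω : Type*}

theorem isClosedSubgroup_blockGroup {ι : Type*} (b : Ω → ι) :
    IsClosedSubgroup (blockGroup b) :=
  isClosedSubgroup_iff.mpr fun f hf x => by
    obtain ⟨g, hg, h⟩ := hf {x} (finite_singleton x)
    rw [← h x rfl, hg x]

theorem swap_mem_pointwiseStabilizer [DecidableEq Ω] {ι : Type*} {b : Ω → ι} {T : Set Ω}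
    {x y : Ω} (hxy : b x = b y) (hx : x ∉ T) (hy : y ∉ T) :
    Equiv.swap x y ∈ pointwiseStabilizer (blockGroup b) T := by
  refine ⟨fun z => ?_, fun z hz => Equiv.swap_apply_of_ne_of_ne ?_ ?_⟩
  · rcases eq_or_ne z x with rfl | hzx
    · rw [Equiv.swap_apply_left, hxy]
    · rcases eq_or_ne z y with rfl | hzy
      · rw [Equiv.swap_apply_right, hxy]
      · rw [Equiv.swap_apply_of_ne_of_ne hzx hzy]
  · rintro rfl; exact hx hz
  · rintro rfl; exact hy hz

theorem orbit_blockGroup_subset {ι : Type*} {b : Ω → ι} {T : Set Ω} (x : Ω) :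
    MulAction.orbit (pointwiseStabilizer (blockGroup b) T) x ⊆ {y | b y = b x} := by
  rintro _ ⟨g, rfl⟩
  exact g.2.1 x

theorem subset_orbit_blockGroup {ι : Type*} {b : Ω → ι} {T : Set Ω} {x : Ω}
    (h : ∀ y, b y = b x → y ∉ T) :
    {y | b y = b x} ⊆ MulAction.orbit (pointwiseStabilizer (blockGroup b) T) x := by
  classical
  intro y hy
  exact mem_orbit_iff'.mpr ⟨Equiv.swap x y,
    swap_mem_pointwiseStabilizer (Eq.symm hy) (h x rfl) (h y hy), Equiv.swap_apply_left x y⟩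

theorem encard_fiber {d : ℕ → ℕ} (E : Blocks d ≃ Ω) (m : ℕ) :
    {x | (E.symm x).1 = m}.encard = d m := by
  have hinj : Function.Injective fun i : Fin (d m) => E ⟨m, i⟩ := fun i j h => by
    simpa using h
  have : {x | (E.symm x).1 = m} = range fun i : Fin (d m) => E ⟨m, i⟩ := by
    ext x
    constructor
    · rintro rfl
      exact ⟨(E.symm x).2, by simp⟩
    · rintro ⟨i, rfl⟩
      simp
  rw [this, ← image_univ, hinj.encard_image]
  simp

theorem exists_avoiding_block {d : ℕ → ℕ} (E : Blocks d ≃ Ω) {T : Set Ω} (hT : T.Finite) (n : ℕ) :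
    ∃ m > n, ∀ x, (E.symm x).1 = m → x ∉ T := by
  obtain ⟨m, hm⟩ := ((hT.image fun x => (E.symm x).1).union (finite_Iic n)).exists_notMem
  refine ⟨m, not_le.mp fun h => hm (Or.inr h), ?_⟩
  rintro x rfl hx
  exact hm (Or.inl ⟨x, hx, rfl⟩)

/-- Each of the four conditions is satisfied by some closed subgroup. -/
theorem exists_closed_orbitCondition [Countable Ω] [Infinite Ω] (i : Fin 4) :
    ∃ G : Subgroup (Perm Ω), IsClosedSubgroup G ∧ orbitCondition i G := by
  classical
  fin_cases i
  · refine ⟨blockGroup fun _ => (), isClosedSubgroup_blockGroup _, fun T hT => ?_⟩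
    obtain ⟨x, hx⟩ := hT.exists_notMem
    refine ⟨x, hT.infinite_compl.mono fun y hy => ?_⟩
    exact mem_orbit_iff'.mpr ⟨Equiv.swap x y, swap_mem_pointwiseStabilizer rfl hx hy,
      Equiv.swap_apply_left x y⟩
  · have : Infinite (Blocks fun m => m + 1) :=
      Infinite.of_injective (fun m => ⟨m, 0⟩) fun m m' h => congrArg Sigma.fst h
    obtain ⟨E⟩ := nonempty_equiv_of_countable (α := Blocks fun m => m + 1) (β := Ω)
    refine ⟨blockGroup fun x => (E.symm x).1, isClosedSubgroup_blockGroup _,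
      ⟨∅, finite_empty, fun x => ?_⟩, ?_⟩
    · exact (finite_of_encard_eq_coe (encard_fiber E _)).subset (orbit_blockGroup_subset x)
    · rintro T hT ⟨n, hn⟩
      obtain ⟨m, hm, hmT⟩ := exists_avoiding_block E hT n
      have h1 := hn (E ⟨m, 0⟩)
      have h2 := encard_le_encard (subset_orbit_blockGroup (b := fun x => (E.symm x).1) (T := T)
        (x := E ⟨m, 0⟩) fun y hy => hmT y (by simpa using hy))
      rw [encard_fiber E] at h2
      have h3 := h2.trans h1
      simp only [Equiv.symm_apply_apply] at h3
      have : m + 1 ≤ n := by exact_mod_cast h3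
      omega
  · have : Infinite (Blocks fun _ => 2) :=
      Infinite.of_injective (fun m => ⟨m, 0⟩) fun m m' h => congrArg Sigma.fst h
    obtain ⟨E⟩ := nonempty_equiv_of_countable (α := Blocks fun _ => 2) (β := Ω)
    refine ⟨blockGroup fun x => (E.symm x).1, isClosedSubgroup_blockGroup _,
      ⟨∅, finite_empty, 2, two_pos, fun x => ?_⟩, fun T hT hbot => ?_⟩
    · exact (encard_le_encard (orbit_blockGroup_subset x)).trans (encard_fiber E _).le
    · obtain ⟨m, -, hmT⟩ := exists_avoiding_block E hT 0
      have h1 : Equiv.swap (E ⟨m, 0⟩) (E ⟨m, 1⟩) ∈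
          pointwiseStabilizer (blockGroup fun x => (E.symm x).1) T :=
        swap_mem_pointwiseStabilizer (by simp) (hmT _ (by simp)) (hmT _ (by simp))
      rw [hbot, Subgroup.mem_bot, Equiv.swap_eq_one_iff] at h1
      simp at h1
  · refine ⟨⊥, isClosedSubgroup_iff.mpr fun f hf => ?_, ∅, finite_empty,
      eq_bot_iff.mpr (pointwiseStabilizer_le _ _)⟩
    rw [Subgroup.mem_bot]
    ext x
    obtain ⟨g, hg, h⟩ := hf {x} (finite_singleton x)
    rw [← h x rfl, Subgroup.mem_bot.mp hg]

end Examples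

end PermGroupClasses

theorem mainTheorem11 (Ω : Type*) [Countable Ω] [Infinite Ω] :
    Equivalence (PermGroupClasses.SEquiv (Ω := Ω)) ∧
    (∀ G : Subgroup (Equiv.Perm Ω), PermGroupClasses.IsClosedSubgroup G →
      ∃! i : Fin 4, PermGroupClasses.orbitCondition i G) ∧
    (∀ G₁ G₂ : Subgroup (Equiv.Perm Ω),
      PermGroupClasses.IsClosedSubgroup G₁ → PermGroupClasses.IsClosedSubgroup G₂ →
      (PermGroupClasses.SEquiv G₁ G₂ ↔
        ∃ i : Fin 4, PermGroupClasses.orbitCondition i G₁ ∧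
          PermGroupClasses.orbitCondition i G₂)) ∧
    (∀ i : Fin 4, ∃ G : Subgroup (Equiv.Perm Ω),
      PermGroupClasses.IsClosedSubgroup G ∧ PermGroupClasses.orbitCondition i G) := by
  refine ⟨PermGroupClasses.sEquiv_equivalence, fun G hG => ?_, fun G₁ G₂ h₁ h₂ => ⟨fun h => ?_, ?_⟩,
    PermGroupClasses.exists_closed_orbitCondition⟩
  · obtain ⟨i, hi⟩ := PermGroupClasses.exists_orbitCondition G
    exact ⟨i, hi, fun j hj => PermGroupClasses.orbitCondition_unique hG hG
      (PermGroupClasses.sEquiv_equivalence.refl G) hj hi⟩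
  · obtain ⟨i, hi⟩ := PermGroupClasses.exists_orbitCondition G₁
    obtain ⟨j, hj⟩ := PermGroupClasses.exists_orbitCondition G₂
    obtain rfl := PermGroupClasses.orbitCondition_unique h₁ h₂ h hi hj
    exact ⟨i, hi, hj⟩
  · rintro ⟨i, hi, hj⟩
    exact PermGroupClasses.sEquiv_iff.mpr ⟨PermGroupClasses.le_of_orbitCondition h₂ hi hj,
      PermGroupClasses.le_of_orbitCondition h₁ hj hi⟩
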